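/- **Setting.** Let $n\ge 1$, $d\ge 0$ and let $f_1,\dots,f_n:\mathbb R^d\to\mathbb R$ be $L$-smooth (differentiable, with $\|\nabla f_i(z)-\nabla f_i(y)\|\le L\|z-y\|$ for all $z,y$). Let $f=\frac1n\sum_{i=1}^n f_i$ be bounded below, $f^\star=\inf f$, and assume the Polyak–Łojasiewicz inequality $2\mu\,(f(x)-f^\star)\le\|\nabla f(x)\|^2$ for all $x$, with $0<\mu\le L$ (the inequality $\mu\le L$ is automatic unless $f$ is constant). Let $W=[w_{ij}]\in\mathbb R^{n\times n}$ be symmetric, doubly stochastic, primitive and positive semidefinite; let $\lambda=\rho\big(W-\frac1n\mathbf 1\mathbf 1^{\mathsf T}\big)$ be its mixing rate and $\underline\lambda$ its smallest nonzero eigenvalue. Stochastic ED/D$^2$ with step size $\alpha>0$ starts from a common deterministic point $x_i^0=x^0\in\mathbb R^d$ and iterates $$x_i^{1}=\sum_{j}w_{ij}\big(x_j^0-\alpha\nabla F_j(x_j^0;\xi_j^0)\big),\qquad x_i^{k+2}=\sum_{j}w_{ij}\Big(2x_j^{k+1}-x_j^{k}-\alpha\big(\nabla F_j(x_j^{k+1};\xi_j^{k+1})-\nabla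 F_j(x_j^{k};\xi_j^{k})\big)\Big),$$ where $\nabla F_i(x;\xi_i^k)$ is a stochastic gradient, measurable jointly in the point and the sample. With $\mathcal F^k$ the $\sigma$-algebra generated by $\mathbf x^0,\dots,\mathbf x^k$ ($\mathbf x^t=(x_1^t,\dots,x_n^t)$), assume for all $i$ and $k$ that $$\mathbb E\big[\nabla F_i(x_i^k;\xi_i^k)-\nabla f_i(x_i^k)\,\big|\,\mathcal F^k\big]=0,\qquad \mathbb E\big[\|\nabla F_i(x_i^k;\xi_i^k)-\nabla f_i(x_i^k)\|^2\,\big|\,\mathcal F^k\big]\le\sigma^2,$$ and that, for each $k$, the samples $\xi_1^k,\dots,\xi_n^k$ are independent conditionally on $\mathcal F^k$. Put $\zeta_0^2=\frac1n\sum_{i}\big\|\sum_j w_{ij}\nabla f_j(x^0)-\nabla f(x^0)\big\|^2$. Call $\alpha>0$ *admissible* if $$\alpha\le\min\left\{\frac{1-\sqrt\lambda}{3L},\ \frac{\sqrt{1-\lambda}}{2L},\ \frac{(1-\sqrt\lambda)\,\underline\lambda}{2\sqrt{12}\,L\lambda},\ \left(\frac{\mu(1-\lambda)(1-\sqrt\lambda)\,\underline\lambda}{18L^4}\right)^{1/3}\right\},$$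 where the third term is $+\infty$ if $\lambda=0$. **Claim.** There are an absolute constant $C_0$ and a constant $C$ depending only on $L$ and $\mu$ such that the following hold. 1. For every admissible $\alpha$ and every $k\ge 0$ (all expectations being finite), $$\frac1n\sum_{i=1}^n\mathbb E[f(x_i^k)-f^\star]\le\Big(1-\frac{\alpha\mu}{2}\Big)^k r_0+C_0\left(\frac{\alpha L\sigma^2}{\mu n}+\frac{\alpha^2L^2\lambda^2\sigma^2}{\mu(1-\lambda)\underline\lambda}+\frac{\alpha^4L^4\lambda^2\sigma^2}{\mu(1-\lambda)^3\underline\lambda\, n}\right),$$ where $r_0=2\,(f(x^0)-f^\star)+\dfrac{8\alpha^2L\zeta_0^2}{(1-\lambda)\underline\lambda}$. 2. For every integer $K\ge 2$ such that $\alpha=2\ln(K^2)/(\mu K)$ is admissible, with this $\alpha$, $$\frac1n\sum_{i=1}^n\mathbb E[f(x_i^K)-f^\star]\le\frac{2\,(f(x^0)-f^\star)}{K^2}+C(\ln K)^4\left(\frac{\sigma^2}{Kn}+\frac{\lambda^2\sigma^2}{K^2(1-\lambda)\underline\lambda}+\frac{\zeta_0^2}{K^4(1-\lambda)\underline\lambda}+\frac{\lambda^2\sigma^2}{K^4(1-\lambda)^3\underline\lambda\,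 n}\right).$$ If moreover $K\ge\dfrac{n}{(1-\lambda)\underline\lambda}$ (that is, the transient time is $O(n/(1-\lambda))$ when $\underline\lambda$ is treated as a constant), then $$\frac1n\sum_{i=1}^n\mathbb E[f(x_i^K)-f^\star]\le C(\ln K)^4\,\frac{f(x^0)-f^\star+\sigma^2+\zeta_0^2}{nK}.$$ 3. The step size $\alpha=2\ln(K^2)/(\mu K)$ is admissible for every $K\ge 2$ with $K\ge\dfrac{C\ln K}{(1-\lambda)\underline\lambda}$, hence for all sufficiently large $K$. -/

import Mathlib

open MeasureTheory ProbabilityTheory Filter Topology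

noncomputable section

/-- The decision space `ℝᵈ` with its Euclidean norm. -/
abbrev Vec (d : ℕ) : Type := EuclideanSpace ℝ (Fin d)

/-- Network combination matrix: doubly stochastic (entrywise nonnegative, rows and columns
summing to one), symmetric and primitive. -/
structure IsCombinationMatrix {n : ℕ} (W : Matrix (Fin n) (Fin n) ℝ) : Prop where
  doublyStochastic : W ∈ doublyStochastic ℝ (Fin n)
  symm : W.IsSymm
  primitive : W.IsPrimitive

/-- Mixing rate `λ = ρ(W - (1/n) 𝟙 𝟙ᵀ)`. It is used for symmetric `W` only, where all the
eigenvalues are real, so that the real spectrum is the whole spectrum. -/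
def mixingRate {n : ℕ} (W : Matrix (Fin n) (Fin n) ℝ) : ℝ :=
  (spectralRadius ℝ (W - Matrix.of (fun _ _ : Fin n => 1 / (n : ℝ)))).toReal

/-- Smallest nonzero eigenvalue of `W` (for symmetric `W`; the set is finite, and it contains
`1` if `W` is a combination matrix). -/
def minNonzeroEigenvalue {n : ℕ} (W : Matrix (Fin n) (Fin n) ℝ) : ℝ :=
  sInf {t : ℝ | t ∈ spectrum ℝ W ∧ t ≠ 0}

/-- The aggregate cost `f(x) = (1/n) ∑ᵢ fᵢ(x)`. -/
def aggregate {n d : ℕ} (f : Fin n → Vec d → ℝ) (x : Vec d) : ℝ :=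
  (1 / (n : ℝ)) * ∑ i, f i x

/-- `g` is `L`-smooth: differentiable with `L`-Lipschitz gradient. -/
def IsLSmooth {d : ℕ} (L : ℝ) (g : Vec d → ℝ) : Prop :=
  Differentiable ℝ g ∧ ∀ z y : Vec d, ‖gradient g z - gradient g y‖ ≤ L * ‖z - y‖

/-- The Polyak-Łojasiewicz inequality with constant `μ`, where `gstar` is the optimal value. -/
def SatisfiesPL {d : ℕ} (μ : ℝ) (g : Vec d → ℝ) (gstar : ℝ) : Prop :=
  ∀ x : Vec d, 2 * μ * (g x - gstar) ≤ ‖gradient g x‖ ^ 2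

/-- `ζ₀² = (1/n) ∑ᵢ ‖∑ⱼ wᵢⱼ ∇fⱼ(x⁰) - ∇f(x⁰)‖²`. -/
def zetaSq {n d : ℕ} (W : Matrix (Fin n) (Fin n) ℝ) (f : Fin n → Vec d → ℝ) (x0 : Vec d) : ℝ :=
  (1 / (n : ℝ)) *
    ∑ i, ‖∑ j, W i j • gradient (f j) x0 - gradient (aggregate f) x0‖ ^ 2

/-- The iterates `xᵢᵏ(ω)` of stochastic ED/D² with step size `α`, started at the same point `x0`
at every agent. `G i x s` is the stochastic gradient `∇Fᵢ(x; s)` of agent `i` at `x` for the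
sample `s`, and `ξ k i ω` is the sample drawn by agent `i` at iteration `k`. -/
def edIterate {n d : ℕ} {Ω : Type*} {Ξ : Fin n → Type*}
    (W : Matrix (Fin n) (Fin n) ℝ) (α : ℝ) (G : ∀ i, Vec d → Ξ i → Vec d)
    (ξ : ℕ → ∀ i, Ω → Ξ i) (x0 : Vec d) : ℕ → Ω → Fin n → Vec d
  | 0, _, _ => x0
  | 1, ω, i => ∑ j, W i j • (x0 - α • G j x0 (ξ 0 j ω))
  | k + 2, ω, i => ∑ j, W i j •
      ((2 : ℝ) • edIterate W α G ξ x0 (k + 1) ω j - edIterate W α G ξ x0 k ω j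
        - α • (G j (edIterate W α G ξ x0 (k + 1) ω j) (ξ (k + 1) j ω)
          - G j (edIterate W α G ξ x0 k ω j) (ξ k j ω)))

/-- The σ-algebra `Fᵏ` generated by `x⁰, …, xᵏ`. -/
@[reducible] def pastSigma {n d : ℕ} {Ω : Type*} (X : ℕ → Ω → Fin n → Vec d) (k : ℕ) : MeasurableSpace Ω :=
  ⨆ t ∈ Finset.range (k + 1), MeasurableSpace.comap (X t) inferInstance

/-- Conditional independence of a finite family of random variables given a σ-algebra `m`:
`P(ζᵢ ∈ Aᵢ for all i | m) = ∏ᵢ P(ζᵢ ∈ Aᵢ | m)` almost surely, for all measurable `Aᵢ`. -/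
def CondIndepGiven {n : ℕ} {Ω : Type*} [MeasurableSpace Ω] {Ξ : Fin n → Type*}
    [∀ i, MeasurableSpace (Ξ i)] (P : Measure Ω) (m : MeasurableSpace Ω)
    (ζ : ∀ i, Ω → Ξ i) : Prop :=
  ∀ A : ∀ i, Set (Ξ i), (∀ i, MeasurableSet (A i)) →
    P[(⋂ i, ζ i ⁻¹' A i).indicator (fun _ => (1 : ℝ)) | m]
      =ᵐ[P] fun ω => ∏ i, (P[(ζ i ⁻¹' A i).indicator (fun _ => (1 : ℝ)) | m]) ω

/-- Gradient noise `∇Fᵢ(xᵢᵏ; ξᵢᵏ) - ∇fᵢ(xᵢᵏ)` along a random trajectory `X`. -/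
def gradNoise {n d : ℕ} {Ω : Type*} {Ξ : Fin n → Type*} (f : Fin n → Vec d → ℝ)
    (G : ∀ i, Vec d → Ξ i → Vec d) (ξ : ℕ → ∀ i, Ω → Ξ i) (X : ℕ → Ω → Fin n → Vec d)
    (k : ℕ) (i : Fin n) (ω : Ω) : Vec d :=
  G i (X k ω i) (ξ k i ω) - gradient (f i) (X k ω i)

/-- The gradient noise assumption along a trajectory `X`: given `x⁰, …, xᵏ` the noise of each
agent has mean zero and variance at most `σ²`, and the samples of the agents are independent.
(`square_integrable` gives the two conditional expectations a meaning.) -/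
structure NoiseAssumption {n d : ℕ} {Ω : Type*} [MeasurableSpace Ω] {Ξ : Fin n → Type*}
    [∀ i, MeasurableSpace (Ξ i)] (P : Measure Ω) (f : Fin n → Vec d → ℝ)
    (G : ∀ i, Vec d → Ξ i → Vec d) (ξ : ℕ → ∀ i, Ω → Ξ i) (X : ℕ → Ω → Fin n → Vec d)
    (σ : ℝ) : Prop where
  square_integrable : ∀ k i, MemLp (gradNoise f G ξ X k i) 2 P
  mean_zero : ∀ k i, P[gradNoise f G ξ X k i | pastSigma X k] =ᵐ[P] 0
  variance_le : ∀ k i,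
    P[fun ω => ‖gradNoise f G ξ X k i ω‖ ^ 2 | pastSigma X k] ≤ᵐ[P] fun _ => σ ^ 2
  cond_indep : ∀ k, CondIndepGiven P (pastSigma X k) (ξ k)

/-- The step size conditions, with `l = λ` and `lmin` the smallest nonzero eigenvalue. The third
one is `α ≤ (1-√λ) lmin / (2 √12 L λ)`, multiplied out because it is void if `λ = 0`. -/
def StepSizeOK (L μ l lmin α : ℝ) : Prop :=
  α ≤ (1 - √l) / (3 * L) ∧
  α ≤ √(1 - l) / (2 * L) ∧
  α * (2 * √12 * L * l) ≤ (1 - √l) * lmin ∧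
  α ≤ (μ * (1 - l) * (1 - √l) * lmin / (18 * L ^ 4)) ^ (1 / 3 : ℝ)

/-- The step size `2 ln(K²) / (μ K)`. -/
def horizonStep (μ : ℝ) (K : ℕ) : ℝ := 2 * Real.log ((K : ℝ) ^ 2) / (μ * K)

/-- The error `(1/n) ∑ᵢ E[f(xᵢᵏ) - f⋆]` at iteration `k` of a trajectory `X`. -/
def meanError {n d : ℕ} {Ω : Type*} [MeasurableSpace Ω] (P : Measure Ω) (f : Fin n → Vec d → ℝ)
    (fstar : ℝ) (X : ℕ → Ω → Fin n → Vec d) (k : ℕ) : ℝ :=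
  (1 / (n : ℝ)) * ∑ i, ∫ ω, (aggregate f (X k ω i) - fstar) ∂P

end

/-! The iteration is split into the mean over the agents and its deviation from consensus. Since `W`
is doubly stochastic, the mean performs gradient descent on `f`, perturbed by the averaged noise,
whose variance is at most `σ²/n` by conditional independence, and by a bias of size `L²` times the
mean squared deviation. Smoothness and the PL inequality make its suboptimality contract at rate `1
- αμ` up to these perturbations (`IsEDTrajectory.descent_step`, `expGap_succ_le`).

The deviation is expanded in an orthonormal eigenbasis of `W - 𝟙𝟙ᵀ/n` (`exists_isModalBasis`). In a
mode with eigenvalue `t ≠ 0` the second-order recursion integrates to a first-order system for the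
deviation `p` and a dual variable `q`, a running sum of `p` (`IsEDTrajectory.modal_succ`). With `q`
recentred at the value that balances the local gradients at the mean, the noiseless linear map
multiplies `‖p‖² + ‖q‖²/(t(1-t))` by exactly `t`. Young's inequality spends part of this
contraction, leaving `√λ`, to absorb the errors (`mode_energy_step`). Heterogeneity of the `fᵢ` then
enters only through the initial energy, which is of size `α²ζ₀²/((1-λ)lmin)`.

After taking expectations, gap `F`, energy per agent `e` and squared mean gradient `g` satisfy a
coupled linear recursion. `coupled_recursion` solves it in two passes: a Lyapunov function `F + κe`
bounds the gap, and this bound is fed back into the recursion of `e`. The horizon statements follow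
by inserting `α = 4 ln K/(μK)`, which makes the linear factor at most `K⁻²`. -/

noncomputable section

/-! ### Consequences of smoothness of one function. -/

section Smooth

variable {d : ℕ} {L : ℝ} {g : Vec d → ℝ}

/-- Along the segment from `x` to `y`, the difference of the two sides, seen as a function of time,
has nonpositive derivative by Cauchy-Schwarz and the Lipschitz bound. -/
lemma IsLSmooth.le_quadratic (hg : IsLSmooth L g) (x y : Vec d) :
    g y ≤ g x + inner ℝ (gradient g x) (y - x) + L / 2 * ‖y - x‖ ^ 2 := by
  set v := y - x
  have hline : ∀ t : ℝ, HasDerivAt (fun t : ℝ => x + t • v) v t := fun t => by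
    simpa using ((hasDerivAt_id t).smul_const v).const_add x
  have hd : ∀ t : ℝ, HasDerivAt (fun t : ℝ => g (x + t • v))
      (inner ℝ (gradient g (x + t • v)) v) t := fun t => by
    exact (hg.1 (x + t • v)).hasGradientAt.hasFDerivAt.comp_hasDerivAt t (hline t)
  have hq : ∀ t : ℝ, HasDerivAt
      (fun t : ℝ => g (x + t • v) - t * inner ℝ (gradient g x) v - L / 2 * ‖v‖ ^ 2 * t ^ 2)
      (inner ℝ (gradient g (x + t • v)) v - inner ℝ (gradient g x) v - L * ‖v‖ ^ 2 * t) t :=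
    fun t => by
      have h2 := ((hd t).sub ((hasDerivAt_id t).mul_const (inner ℝ (gradient g x) v))).sub
        (((hasDerivAt_pow 2 t)).const_mul (L / 2 * ‖v‖ ^ 2))
      refine h2.congr_deriv ?_
      push_cast; ring
  have hanti : AntitoneOn
      (fun t : ℝ => g (x + t • v) - t * inner ℝ (gradient g x) v - L / 2 * ‖v‖ ^ 2 * t ^ 2)
      (Set.Icc 0 1) := by
    refine antitoneOn_of_deriv_nonpos (convex_Icc 0 1)
      (fun t _ => (hq t).continuousAt.continuousWithinAt)
      (fun t _ => (hq t).differentiableAt.differentiableWithinAt) fun t ht => ?_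
    rw [interior_Icc] at ht
    rw [(hq t).deriv]
    have h3 : inner ℝ (gradient g (x + t • v)) v - inner ℝ (gradient g x) v
        = inner ℝ (gradient g (x + t • v) - gradient g x) v := by rw [inner_sub_left]
    have h4 := real_inner_le_norm (gradient g (x + t • v) - gradient g x) v
    have h5 := hg.2 (x + t • v) x
    rw [add_sub_cancel_left, norm_smul, Real.norm_of_nonneg ht.1.le] at h5
    nlinarith [norm_nonneg v]
  have := hanti (Set.left_mem_Icc.2 zero_le_one) (Set.right_mem_Icc.2 zero_le_one) zero_le_one
  have hy : x + (1 : ℝ) • v = y := by simp [v]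
  simp only [hy, zero_smul, add_zero] at this
  linarith

lemma IsLSmooth.continuous_gradient (hg : IsLSmooth L g) (hL : 0 ≤ L) :
    Continuous (gradient g) := by
  have : LipschitzWith L.toNNReal (gradient g) := LipschitzWith.of_dist_le_mul fun x y => by
    rw [dist_eq_norm, dist_eq_norm, Real.coe_toNNReal _ hL]; exact hg.2 x y
  exact this.continuous

/-- A gradient step of length `1/L` lowers `g` by at least `‖∇g‖²/(2L)` and cannot go below `gstar`.
-/
lemma IsLSmooth.norm_gradient_sq_le (hg : IsLSmooth L g) (hL : 0 < L) {gstar : ℝ}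
    (hstar : ∀ x, gstar ≤ g x) (x : Vec d) : ‖gradient g x‖ ^ 2 ≤ 2 * L * (g x - gstar) := by
  have h := hg.le_quadratic x (x - L⁻¹ • gradient g x)
  have h2 := hstar (x - L⁻¹ • gradient g x)
  have e : x - L⁻¹ • gradient g x - x = -(L⁻¹ • gradient g x) := by abel
  rw [e, inner_neg_right, norm_neg, inner_smul_right, norm_smul, real_inner_self_eq_norm_sq,
    Real.norm_of_nonneg (inv_nonneg.2 hL.le)] at h
  have e2 : -(L⁻¹ * ‖gradient g x‖ ^ 2) + L / 2 * (L⁻¹ * ‖gradient g x‖) ^ 2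
      = -(‖gradient g x‖ ^ 2 / (2 * L)) := by field_simp; ring
  have h3 : ‖gradient g x‖ ^ 2 / (2 * L) ≤ g x - gstar := by linarith
  rw [div_le_iff₀ (by positivity)] at h3
  linarith

end Smooth

/-! ### The average of the local costs. -/

section Aggregate

variable {n d : ℕ} {L : ℝ} {f : Fin n → Vec d → ℝ}

lemma hasGradientAt_aggregate (hf : ∀ i, IsLSmooth L (f i)) (x : Vec d) :
    HasGradientAt (aggregate f) ((1 / (n : ℝ)) • ∑ i, gradient (f i) x) x := by
  rw [hasGradientAt_iff_hasFDerivAt]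
  have h : HasFDerivAt (fun x => ∑ i, f i x)
      (∑ i, InnerProductSpace.toDual ℝ (Vec d) (gradient (f i) x)) x :=
    HasFDerivAt.fun_sum fun i _ => ((hf i).1 x).hasGradientAt.hasFDerivAt
  have h2 := h.const_mul (1 / (n : ℝ))
  rw [map_smul, map_sum]
  exact h2

lemma gradient_aggregate (hf : ∀ i, IsLSmooth L (f i)) (x : Vec d) :
    gradient (aggregate f) x = (1 / (n : ℝ)) • ∑ i, gradient (f i) x :=
  (hasGradientAt_aggregate hf x).gradient

lemma norm_mean_sq_le {E : Type*} [SeminormedAddCommGroup E] [NormedSpace ℝ E]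
    (v : Fin n → E) : ‖(1 / (n : ℝ)) • ∑ i, v i‖ ^ 2 ≤ (1 / (n : ℝ)) * ∑ i, ‖v i‖ ^ 2 := by
  rcases Nat.eq_zero_or_pos n with rfl | hn
  · simp
  have hn' : (0 : ℝ) < n := by exact_mod_cast hn
  have h1 : ‖∑ i, v i‖ ^ 2 ≤ n * ∑ i, ‖v i‖ ^ 2 := by
    calc ‖∑ i, v i‖ ^ 2 ≤ (∑ i, ‖v i‖) ^ 2 := by gcongr; exact norm_sum_le _ _
      _ ≤ _ := by simpa using sq_sum_le_card_mul_sum_sq (s := Finset.univ) (f := fun i => ‖v i‖)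
  rw [norm_smul, mul_pow, Real.norm_of_nonneg (by positivity)]
  calc (1 / (n : ℝ)) ^ 2 * ‖∑ i, v i‖ ^ 2 ≤ (1 / (n : ℝ)) ^ 2 * (n * ∑ i, ‖v i‖ ^ 2) := by gcongr
    _ = _ := by field_simp

lemma isLSmooth_aggregate (hn : 0 < n) (hf : ∀ i, IsLSmooth L (f i)) :
    IsLSmooth L (aggregate f) := by
  have hn' : (0 : ℝ) < n := by exact_mod_cast hn
  refine ⟨fun x => (hasGradientAt_aggregate hf x).differentiableAt, fun z y => ?_⟩
  rw [gradient_aggregate hf, gradient_aggregate hf, ← smul_sub, ← Finset.sum_sub_distrib,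
    norm_smul, Real.norm_of_nonneg (by positivity)]
  calc (1 / (n : ℝ)) * ‖∑ i, (gradient (f i) z - gradient (f i) y)‖
      ≤ (1 / (n : ℝ)) * ∑ _i : Fin n, L * ‖z - y‖ := by
        gcongr
        exact (norm_sum_le _ _).trans (Finset.sum_le_sum fun i _ => (hf i).2 z y)
    _ = L * ‖z - y‖ := by simp; field_simp

/-- The quadratic bound is expanded at the mean, where the linear terms cancel because the
deviations sum to zero. This transfers bounds at the mean to the individual agents. -/
lemma mean_aggregate_le (hn : 0 < n) (hf : ∀ i, IsLSmooth L (f i)) (x : Fin n → Vec d) :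
    (1 / (n : ℝ)) * ∑ i, aggregate f (x i) ≤ aggregate f ((1 / (n : ℝ)) • ∑ i, x i)
      + L / 2 * ((1 / (n : ℝ)) * ∑ i, ‖x i - (1 / (n : ℝ)) • ∑ j, x j‖ ^ 2) := by
  have hn' : (0 : ℝ) < n := by exact_mod_cast hn
  set z := (1 / (n : ℝ)) • ∑ i, x i with hz
  have h := Finset.sum_le_sum fun i (_ : i ∈ Finset.univ) =>
    (isLSmooth_aggregate hn hf).le_quadratic z (x i)
  have h0 : ∑ i, (x i - z) = 0 := by
    rw [Finset.sum_sub_distrib, Finset.sum_const, Finset.card_univ, Fintype.card_fin, hz,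
      ← Nat.cast_smul_eq_nsmul ℝ, smul_smul, mul_one_div_cancel hn'.ne', one_smul, sub_self]
  rw [Finset.sum_add_distrib, Finset.sum_add_distrib, ← inner_sum, h0, inner_zero_right,
    ← Finset.mul_sum, Finset.sum_const, Finset.card_univ, Fintype.card_fin, nsmul_eq_mul] at h
  calc (1 / (n : ℝ)) * ∑ i, aggregate f (x i) ≤ (1 / (n : ℝ)) * (n * aggregate f z + 0
        + L / 2 * ∑ i, ‖x i - z‖ ^ 2) := by gcongr
    _ = _ := by field_simp; ring

end Aggregate

/-! ### Spectral decomposition of the combination matrix. -/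

section Spectral

open Matrix

variable {n : ℕ} {W : Matrix (Fin n) (Fin n) ℝ}

lemma mem_spectrum_of_mulVec_eq_smul {v : Fin n → ℝ} {s : ℝ} (hv : v ≠ 0)
    (h : W *ᵥ v = s • v) : s ∈ spectrum ℝ W := by
  rw [spectrum.mem_iff]
  rintro ⟨A, hA⟩
  apply hv
  have h0 : (A : Matrix (Fin n) (Fin n) ℝ) *ᵥ v = 0 := by
    rw [hA, Matrix.sub_mulVec, h, Algebra.algebraMap_eq_smul_one, Matrix.smul_mulVec,
      Matrix.one_mulVec, sub_self]
  calc v = ((↑A⁻¹ : Matrix (Fin n) (Fin n) ℝ) * (A : Matrix (Fin n) (Fin n) ℝ)) *ᵥ v := by simp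
    _ = 0 := by rw [← Matrix.mulVec_mulVec, h0, Matrix.mulVec_zero]

lemma pow_mulVec_eq_smul {v : Fin n → ℝ} {s : ℝ} (h : W *ᵥ v = s • v) (m : ℕ) :
    (W ^ m) *ᵥ v = s ^ m • v := by
  induction m with
  | zero => simp
  | succ m ih => rw [pow_succ, ← Matrix.mulVec_mulVec, h, Matrix.mulVec_smul, ih, smul_smul,
      pow_succ, mul_comm]

/-- Maximum principle for an entrywise positive power `W ^ m`: `v` is not constant, so averaging
strictly lowers its largest coordinate, which is nonnegative since `v` sums to zero. An eigenvalue
`s ≥ 1` would not lower it. -/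
lemma IsCombinationMatrix.eigenvalue_lt_one (hW : IsCombinationMatrix W) {v : Fin n → ℝ} {s : ℝ}
    (hv : v ≠ 0) (hsum : ∑ i, v i = 0) (h : W *ᵥ v = s • v) : s < 1 := by
  by_contra! hs
  obtain ⟨m, -, hpos⟩ := hW.primitive.exists_pos_pow
  have hne : (Finset.univ : Finset (Fin n)).Nonempty := by
    by_contra hemp
    apply hv
    ext i
    exact absurd ⟨i, Finset.mem_univ i⟩ hemp
  obtain ⟨i, -, hi⟩ := Finset.exists_max_image Finset.univ v hne
  obtain ⟨j, hj⟩ : ∃ j, v j ≠ v i := by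
    by_contra! hall
    have h2 : ∑ j : Fin n, v j = n * v i := by simp [hall]
    have hn : (n : ℝ) ≠ 0 := by
      have := i.pos
      positivity
    have h3 : v i = 0 := by
      rw [hsum] at h2
      exact (mul_eq_zero.1 h2.symm).resolve_left hn
    exact hv (funext fun j => by simp [hall, h3])
  have hi0 : 0 ≤ v i := by
    by_contra! hneg
    have : ∑ j, v j < 0 :=
      Finset.sum_neg (fun j hj => (hi j hj).trans_lt hneg) hne
    linarith
  have hrow : ∑ j, (W ^ m) i j = 1 :=
    sum_row_of_mem_doublyStochastic (pow_mem hW.doublyStochastic m) i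
  have hlt : ((W ^ m) *ᵥ v) i < v i := by
    calc ((W ^ m) *ᵥ v) i = ∑ j, (W ^ m) i j * v j := rfl
      _ < ∑ j, (W ^ m) i j * v i := by
        refine Finset.sum_lt_sum
          (fun k hk => mul_le_mul_of_nonneg_left (hi k hk) (hpos i k).le)
          ⟨j, Finset.mem_univ j, mul_lt_mul_of_pos_left
            (lt_of_le_of_ne (hi j (Finset.mem_univ j)) hj) (hpos i j)⟩
      _ = v i := by rw [← Finset.sum_mul, hrow, one_mul]
  rw [pow_mulVec_eq_smul h] at hlt
  have : v i ≤ s ^ m * v i := le_mul_of_one_le_left hi0 (one_le_pow₀ hs)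
  simp only [Pi.smul_apply, smul_eq_mul] at hlt
  linarith

/-- An orthonormal family `u` diagonalizing `W` on the complement of the consensus direction, with
eigenvalues `t j` in `[0, l]`, the nonzero ones at least `lmin`. -/
structure IsModalBasis (W : Matrix (Fin n) (Fin n) ℝ) (l lmin : ℝ) (u : Fin n → Fin n → ℝ)
    (t : Fin n → ℝ) : Prop where
  orthonormal : ∀ i k, ∑ j, u j i * u j k = if i = k then 1 else 0
  nonneg : ∀ j, 0 ≤ t j
  le : ∀ j, t j ≤ l
  lmin_le : ∀ j, t j ≠ 0 → lmin ≤ t j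
  sum_eq_zero : ∀ j, t j ≠ 0 → ∑ i, u j i = 0
  eigen : ∀ j, t j ≠ 0 → ∀ i, ∑ k, u j k * W k i = t j * u j i
  null : ∀ j, t j = 0 → ∀ i, ∑ k, u j k * (W k i - 1 / (n : ℝ)) = 0

lemma IsModalBasis.parseval {l lmin : ℝ} {u : Fin n → Fin n → ℝ} {t : Fin n → ℝ}
    (hu : IsModalBasis W l lmin u t) {d : ℕ} (x : Fin n → Vec d) :
    ∑ j, ‖∑ i, u j i • x i‖ ^ 2 = ∑ i, ‖x i‖ ^ 2 := by
  calc ∑ j, ‖∑ i, u j i • x i‖ ^ 2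
      = ∑ j, ∑ i, ∑ k, (u j i * u j k) * inner ℝ (x i) (x k) := by
        refine Finset.sum_congr rfl fun j _ => ?_
        rw [← real_inner_self_eq_norm_sq, sum_inner]
        refine Finset.sum_congr rfl fun i _ => ?_
        rw [inner_sum]
        refine Finset.sum_congr rfl fun k _ => ?_
        rw [real_inner_smul_left, real_inner_smul_right, mul_assoc]
    _ = ∑ i, ∑ k, (∑ j, u j i * u j k) * inner ℝ (x i) (x k) := by
        rw [Finset.sum_comm]
        refine Finset.sum_congr rfl fun i _ => ?_
        rw [Finset.sum_comm]
        simp_rw [Finset.sum_mul]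
    _ = _ := by simp [hu.orthonormal]

lemma spectralRadius_eq_of_isMax {M : Matrix (Fin n) (Fin n) ℝ} {t : Fin n → ℝ}
    (hspec : spectrum ℝ M = Set.range t) (ht : ∀ j, 0 ≤ t j) {j : Fin n} (hj : ∀ i, t i ≤ t j) :
    (spectralRadius ℝ M).toReal = t j := by
  have : spectralRadius ℝ M = (‖t j‖₊ : ENNReal) := by
    unfold spectralRadius
    rw [hspec]
    apply le_antisymm
    · refine iSup₂_le ?_
      rintro _ ⟨i, rfl⟩
      simp only [ENNReal.coe_le_coe]
      rw [← NNReal.coe_le_coe, coe_nnnorm, coe_nnnorm, Real.norm_of_nonneg (ht i),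
        Real.norm_of_nonneg (ht j)]
      exact hj i
    · exact le_iSup₂ (f := fun k (_ : k ∈ Set.range t) => (‖k‖₊ : ENNReal)) (t j) ⟨j, rfl⟩
  rw [this, ENNReal.coe_toReal, coe_nnnorm, Real.norm_of_nonneg (ht j)]

/-- The basis diagonalizes `M = W - 𝟙𝟙ᵀ/n` rather than `W`. The columns of `M` sum to zero, so an
eigenvector with `t ≠ 0` is orthogonal to `𝟙` and is an eigenvector of `W` as well; hence `lmin ≤ t
< 1`. The consensus direction and the kernel of `W` both go into the modes with `t = 0`, and the
mixing rate is the largest `t`. -/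
lemma exists_isModalBasis (hn : 0 < n) (hW : IsCombinationMatrix W) (hpsd : W.PosSemidef) :
    0 ≤ mixingRate W ∧ mixingRate W < 1 ∧ 0 < minNonzeroEigenvalue W ∧
    minNonzeroEigenvalue W ≤ 1 ∧ (mixingRate W ≠ 0 → minNonzeroEigenvalue W ≤ mixingRate W) ∧
    ∃ u t, IsModalBasis W (mixingRate W) (minNonzeroEigenvalue W) u t := by
  have hn' : (n : ℝ) ≠ 0 := by exact_mod_cast hn.ne'
  have hfin : (spectrum ℝ W).Finite := finite_real_spectrum
  have hmem : (1 : ℝ) ∈ {s : ℝ | s ∈ spectrum ℝ W ∧ s ≠ 0} := by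
    refine ⟨mem_spectrum_of_mulVec_eq_smul (v := 1) ?_ ?_, one_ne_zero⟩
    · intro h
      exact one_ne_zero (congrFun h ⟨0, hn⟩)
    · rw [one_smul, mulVec_one_of_mem_doublyStochastic hW.doublyStochastic]
  have hbdd : BddBelow {s : ℝ | s ∈ spectrum ℝ W ∧ s ≠ 0} :=
    (hfin.subset fun s hs => hs.1).bddBelow
  have hmin : minNonzeroEigenvalue W ∈ {s : ℝ | s ∈ spectrum ℝ W ∧ s ≠ 0} :=
    Set.Nonempty.csInf_mem ⟨1, hmem⟩ (hfin.subset fun s hs => hs.1)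
  have hmin_le : ∀ s ∈ spectrum ℝ W, s ≠ 0 → minNonzeroEigenvalue W ≤ s := fun s hs hs0 =>
    csInf_le hbdd ⟨hs, hs0⟩
  have hmin_pos : 0 < minNonzeroEigenvalue W := by
    obtain ⟨h1, h2⟩ := hmin
    rw [hpsd.1.spectrum_real_eq_range_eigenvalues] at h1
    obtain ⟨i, hi⟩ := h1
    exact lt_of_le_of_ne (hi ▸ hpsd.eigenvalues_nonneg i) h2.symm
  set M : Matrix (Fin n) (Fin n) ℝ := W - Matrix.of (fun _ _ : Fin n => 1 / (n : ℝ)) with hMdef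
  have hMapp : ∀ i k, M i k = W i k - 1 / (n : ℝ) := fun i k => rfl
  have hsym : ∀ i k, W k i = W i k := fun i k => hW.symm.apply i k
  have hM : M.IsHermitian := by
    ext i k
    simp [hMapp, hsym]
  set t := hM.eigenvalues with ht
  set u : Fin n → Fin n → ℝ := fun j i => hM.eigenvectorBasis j i with hu
  have hMu : ∀ j, M *ᵥ u j = t j • u j := fun j => hM.mulVec_eigenvectorBasis j
  have hu0 : ∀ j, u j ≠ 0 := fun j h => by
    have := hM.eigenvectorBasis.orthonormal.ne_zero j
    apply this
    ext i
    exact congrFun h i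
  have hsum : ∀ j, t j ≠ 0 → ∑ i, u j i = 0 := fun j hj => by
    have h1 : ∑ i, (M *ᵥ u j) i = 0 := by
      simp only [mulVec, dotProduct]
      rw [Finset.sum_comm]
      simp_rw [← Finset.sum_mul, hMapp, Finset.sum_sub_distrib,
        sum_col_of_mem_doublyStochastic hW.doublyStochastic]
      simp [hn']
    rw [hMu] at h1
    simp only [Pi.smul_apply, smul_eq_mul, ← Finset.mul_sum] at h1
    exact (mul_eq_zero.1 h1).resolve_left hj
  have hWu : ∀ j, t j ≠ 0 → W *ᵥ u j = t j • u j := fun j hj => by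
    rw [← hMu, hMdef, Matrix.sub_mulVec]
    have : (Matrix.of (fun _ _ : Fin n => 1 / (n : ℝ))) *ᵥ u j = 0 := by
      ext i
      simp only [mulVec, dotProduct, Matrix.of_apply, ← Finset.mul_sum, hsum j hj, mul_zero,
        Pi.zero_apply]
    rw [this, sub_zero]
  have hspec : ∀ j, t j ≠ 0 → t j ∈ spectrum ℝ W := fun j hj =>
    mem_spectrum_of_mulVec_eq_smul (hu0 j) (hWu j hj)
  have ht0 : ∀ j, 0 ≤ t j := fun j => by
    by_cases hj : t j = 0
    · exact hj.ge
    · exact hmin_pos.le.trans (hmin_le _ (hspec j hj) hj)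
  have ht1 : ∀ j, t j < 1 := fun j => by
    by_cases hj : t j = 0
    · rw [hj]; exact one_pos
    · exact hW.eigenvalue_lt_one (hu0 j) (hsum j hj) (hWu j hj)
  obtain ⟨j, -, hj⟩ := Finset.exists_max_image Finset.univ t ⟨⟨0, hn⟩, Finset.mem_univ _⟩
  have hrate : mixingRate W = t j := spectralRadius_eq_of_isMax
    hM.spectrum_real_eq_range_eigenvalues ht0 fun i => hj i (Finset.mem_univ i)
  refine ⟨hrate ▸ ht0 j, hrate ▸ ht1 j, hmin_pos, csInf_le hbdd hmem,
    fun h => hrate ▸ hmin_le _ (hspec j (hrate ▸ h)) (hrate ▸ h), u, t, ?_, ht0,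
    fun i => hrate ▸ hj i (Finset.mem_univ i), fun i hi => hmin_le _ (hspec i hi) hi, hsum,
    fun i hi k => ?_, fun i hi k => ?_⟩
  -- Orthonormality is needed in the completeness form, summed over the modes: this is `U Uᵀ = 1`
  -- for the orthogonal eigenvector matrix.
  · intro i k
    have h := congrFun (congrFun
      ((Matrix.mem_unitaryGroup_iff).1 hM.eigenvectorUnitary.2) i) k
    rw [Matrix.mul_apply, Matrix.one_apply] at h
    exact h
  · have h := congrFun (hWu i hi) k
    simp only [mulVec, dotProduct, Pi.smul_apply, smul_eq_mul] at h
    rw [← h]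
    exact Finset.sum_congr rfl fun m _ => by rw [hsym k m, mul_comm]
  · have h := congrFun (hMu i) k
    simp only [mulVec, dotProduct, Pi.smul_apply, smul_eq_mul, hMapp, hi, zero_mul] at h
    rw [← h]
    exact Finset.sum_congr rfl fun m _ => by rw [hsym k m, mul_comm]

end Spectral

/-! ### Centered variables under conditional independence. -/

section CondIndep

variable {Ω : Type*} {m m₁ m₂ : MeasurableSpace Ω} [m0 : MeasurableSpace Ω] {P : Measure Ω}
  {E : Type*} [NormedAddCommGroup E] [NormedSpace ℝ E]

/-- Integrals over the sets of `m₁ ⊔ m₂` are determined by the intersections of a set of `m₁`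
with a set of `m₂`. -/
lemma setIntegral_eq_of_inter
    (h₁ : m₁ ≤ m0) (h₂ : m₂ ≤ m0)
    {f g : Ω → E} (hf : Integrable f P) (hg : Integrable g P)
    (h : ∀ S T, MeasurableSet[m₁] S → MeasurableSet[m₂] T →
      ∫ ω in S ∩ T, f ω ∂P = ∫ ω in S ∩ T, g ω ∂P)
    {U : Set Ω} (hU : MeasurableSet[m₁ ⊔ m₂] U) :
    ∫ ω in U, f ω ∂P = ∫ ω in U, g ω ∂P := by
  have hle : m₁ ⊔ m₂ ≤ m0 := sup_le h₁ h₂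
  have hgen : m₁ ⊔ m₂ = MeasurableSpace.generateFrom
      (Set.image2 (· ∩ ·) {S | MeasurableSet[m₁] S} {T | MeasurableSet[m₂] T}) := by
    apply le_antisymm
    · refine sup_le (fun S hS => ?_) (fun T hT => ?_)
      · exact MeasurableSpace.measurableSet_generateFrom
          ⟨S, hS, Set.univ, MeasurableSet.univ, Set.inter_univ S⟩
      · exact MeasurableSpace.measurableSet_generateFrom
          ⟨Set.univ, MeasurableSet.univ, T, hT, Set.univ_inter T⟩
    · refine MeasurableSpace.generateFrom_le ?_
      rintro _ ⟨S, hS, T, hT, rfl⟩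
      exact MeasurableSet.inter ((le_sup_left : m₁ ≤ m₁ ⊔ m₂) S hS)
        ((le_sup_right : m₂ ≤ m₁ ⊔ m₂) T hT)
  -- The intersections form a π-system generating `m₁ ⊔ m₂`, so a Dynkin argument extends the
  -- equality to all its sets.
  have hpi : IsPiSystem
      (Set.image2 (· ∩ ·) {S | MeasurableSet[m₁] S} {T | MeasurableSet[m₂] T}) := by
    rintro _ ⟨S, hS, T, hT, rfl⟩ _ ⟨S', hS', T', hT', rfl⟩ -
    exact ⟨S ∩ S', MeasurableSet.inter hS hS', T ∩ T', MeasurableSet.inter hT hT',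
      (Set.inter_inter_inter_comm S S' T T')⟩
  have htot : ∫ ω, f ω ∂P = ∫ ω, g ω ∂P := by
    simpa using h Set.univ Set.univ MeasurableSet.univ MeasurableSet.univ
  refine MeasurableSpace.induction_on_inter
    (C := fun U _ => ∫ ω in U, f ω ∂P = ∫ ω in U, g ω ∂P) hgen hpi (by simp) ?_ ?_ ?_ U hU
  · rintro _ ⟨S, hS, T, hT, rfl⟩
    exact h S T hS hT
  · intro V hV ih
    have e1 := integral_add_compl (hle V hV) hf
    have e2 := integral_add_compl (hle V hV) hg
    rw [ih, htot, ← e2] at e1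
    exact add_left_cancel e1
  · intro V hdis hV ih
    rw [integral_iUnion (fun i => hle _ (hV i)) hdis hf.integrableOn,
      integral_iUnion (fun i => hle _ (hV i)) hdis hg.integrableOn]
    exact tsum_congr ih

variable [CompleteSpace E]

lemma condExp_smul_left_eq {a : Ω → ℝ} {v : Ω → E}
    (ha : StronglyMeasurable[m] a) (hav : Integrable (fun ω => a ω • v ω) P)
    (hv : Integrable v P) : P[fun ω => a ω • v ω | m] =ᵐ[P] fun ω => a ω • (P[v | m]) ω :=
  condExp_bilin_of_stronglyMeasurable_left (ContinuousLinearMap.lsmul ℝ ℝ) ha hav hv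

lemma condExp_smul_right_eq {a : Ω → ℝ} {v : Ω → E}
    (hv : StronglyMeasurable[m] v) (hav : Integrable (fun ω => a ω • v ω) P)
    (ha : Integrable a P) : P[fun ω => a ω • v ω | m] =ᵐ[P] fun ω => (P[a | m]) ω • v ω :=
  condExp_bilin_of_stronglyMeasurable_right (ContinuousLinearMap.lsmul ℝ ℝ) hv hav ha

variable [IsProbabilityMeasure P] {n : ℕ} {Ξ : Fin n → Type*} [∀ i, MeasurableSpace (Ξ i)] 
  {ζ : ∀ i, Ω → Ξ i}

lemma integrable_indicator_one {S : Set Ω} (hS : MeasurableSet S) :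
    Integrable (S.indicator fun _ => (1 : ℝ)) P :=
  (integrable_const 1).indicator hS

/-- The pairwise form of conditional independence. -/
lemma CondIndepGiven.pair (h : CondIndepGiven P m ζ) (hm : m ≤ m0) {i j : Fin n} (hij : i ≠ j)
    {A : Set (Ξ i)} {B : Set (Ξ j)} (hA : MeasurableSet A) (hB : MeasurableSet B) :
    P[(ζ i ⁻¹' A ∩ ζ j ⁻¹' B).indicator (fun _ => (1 : ℝ)) | m]
      =ᵐ[P] fun ω => (P[(ζ i ⁻¹' A).indicator (fun _ => (1 : ℝ)) | m]) ω
        * (P[(ζ j ⁻¹' B).indicator (fun _ => (1 : ℝ)) | m]) ω := by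
  classical
  set S : ∀ k, Set (Ξ k) := Function.update (Function.update (fun _ => Set.univ) i A) j B with hS
  have hSi : S i = A := by simp [hS, Function.update_of_ne hij]
  have hSj : S j = B := by simp [hS]
  have hSk : ∀ k, k ≠ i → k ≠ j → S k = Set.univ := fun k h1 h2 => by
    simp [hS, Function.update_of_ne h1, Function.update_of_ne h2]
  have hmeas : ∀ k, MeasurableSet (S k) := fun k => by
    by_cases h2 : k = j
    · subst h2; rw [hSj]; exact hB
    by_cases h1 : k = i
    · subst h1; rw [hSi]; exact hA
    rw [hSk k h1 h2]; exact MeasurableSet.univ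
  have hinter : (⋂ k, ζ k ⁻¹' S k) = ζ i ⁻¹' A ∩ ζ j ⁻¹' B := by
    ext ω
    simp only [Set.mem_iInter, Set.mem_preimage, Set.mem_inter_iff]
    constructor
    · intro hω
      exact ⟨hSi ▸ hω i, hSj ▸ hω j⟩
    · rintro ⟨h1, h2⟩ k
      by_cases hkj : k = j
      · subst hkj; rw [hSj]; exact h2
      by_cases hki : k = i
      · subst hki; rw [hSi]; exact h1
      rw [hSk k hki hkj]; trivial
  have h' := h S hmeas
  rw [hinter] at h'
  refine h'.trans (Eventually.of_forall fun ω => ?_)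
  have hone : ∀ k, k ∉ ({i, j} : Finset (Fin n)) →
      (P[(ζ k ⁻¹' S k).indicator (fun _ => (1 : ℝ)) | m]) ω = 1 := fun k hk => by
    simp only [Finset.mem_insert, Finset.mem_singleton, not_or] at hk
    rw [hSk k hk.1 hk.2, Set.preimage_univ, Set.indicator_univ, condExp_const hm]
  change ∏ k, (P[(ζ k ⁻¹' S k).indicator (fun _ => (1 : ℝ)) | m]) ω = _
  rw [← Finset.prod_subset (Finset.subset_univ {i, j}) fun k _ hk => hone k hk,
    Finset.prod_pair hij, hSi, hSj]

/-- Given `m`, the sample of agent `i` is independent of `m` and the sample of agent `j`. -/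
lemma CondIndepGiven.condExp_indicator_sup (h : CondIndepGiven P m ζ) (hm : m ≤ m0)
    (hζ : ∀ i, Measurable (ζ i)) {i j : Fin n} (hij : i ≠ j) {A : Set (Ξ i)}
    (hA : MeasurableSet A) :
    P[(ζ i ⁻¹' A).indicator (fun _ => (1 : ℝ)) | m]
      =ᵐ[P] P[(ζ i ⁻¹' A).indicator (fun _ => (1 : ℝ)) |
        m ⊔ MeasurableSpace.comap (ζ j) inferInstance] := by
  have hmj : MeasurableSpace.comap (ζ j) inferInstance ≤ m0 := (hζ j).comap_le
  have hle : m ⊔ MeasurableSpace.comap (ζ j) inferInstance ≤ m0 := sup_le hm hmj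
  have hAi : MeasurableSet (ζ i ⁻¹' A) := hζ i hA
  set a := (ζ i ⁻¹' A).indicator (fun _ => (1 : ℝ)) with ha
  have haint : Integrable a P := integrable_indicator_one hAi
  have hsm : StronglyMeasurable[m ⊔ MeasurableSpace.comap (ζ j) inferInstance] (P[a | m]) :=
    stronglyMeasurable_condExp.mono le_sup_left
  refine ae_eq_condExp_of_forall_setIntegral_eq hle haint
    (fun s _ _ => integrable_condExp.integrableOn) (fun U hU _ => ?_)
    hsm.aestronglyMeasurable
  -- On `S ∩ {ζ j ∈ B}`, conditioning on `m` turns both integrals into the integral over `S` of `P(ζ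
  -- i ∈ A | m) P(ζ j ∈ B | m)`: one by pulling out the `m`-measurable factor, the other by pairwise
  -- conditional independence.
  refine setIntegral_eq_of_inter hm hmj integrable_condExp haint ?_ hU
  rintro S _ hS ⟨B, hB, rfl⟩
  have hBj : MeasurableSet (ζ j ⁻¹' B) := hζ j hB
  set b := (ζ j ⁻¹' B).indicator (fun _ => (1 : ℝ)) with hb
  have hbint : Integrable b P := integrable_indicator_one hBj
  have hind : ∀ g : Ω → ℝ, (fun ω => g ω * b ω) = (ζ j ⁻¹' B).indicator g := fun g => by
    ext ω
    by_cases hω : ω ∈ ζ j ⁻¹' B <;> simp [hb, hω]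
  have hset : ∀ g : Ω → ℝ, ∫ ω in S ∩ ζ j ⁻¹' B, g ω ∂P = ∫ ω in S, g ω * b ω ∂P := fun g => by
    rw [hind, setIntegral_indicator hBj]
  have hpair := h.pair hm hij hA hB
  have hab : (ζ i ⁻¹' A ∩ ζ j ⁻¹' B).indicator (fun _ => (1 : ℝ)) = fun ω => a ω * b ω := by
    rw [hind, Set.inter_comm, ha, Set.indicator_indicator]
  rw [hab] at hpair
  have habint : Integrable (fun ω => a ω * b ω) P := by
    rw [hind]; exact haint.indicator hBj
  have hcbint : Integrable (fun ω => (P[a | m]) ω * b ω) P := by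
    rw [hind]; exact integrable_condExp.indicator hBj
  have hpull : P[fun ω => (P[a | m]) ω * b ω | m] =ᵐ[P] fun ω => (P[a | m]) ω * (P[b | m]) ω :=
    condExp_mul_of_stronglyMeasurable_left stronglyMeasurable_condExp hcbint hbint
  rw [hset, hset, ← setIntegral_condExp hm hcbint hS, ← setIntegral_condExp hm habint hS]
  exact setIntegral_congr_ae (hm S hS) ((hpull.trans hpair.symm).mono fun ω hω _ => hω)

/-- A function of `m` and the sample of agent `j` which is centered given `m` is centered given
`m` and the sample of another agent. -/
lemma CondIndepGiven.condExp_sup_eq_zero (h : CondIndepGiven P m ζ) (hm : m ≤ m0)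
    (hζ : ∀ i, Measurable (ζ i)) {i j : Fin n} (hij : i ≠ j) {v : Ω → E}
    (hv : Integrable v P)
    (hvm : StronglyMeasurable[m ⊔ MeasurableSpace.comap (ζ j) inferInstance] v)
    (hv0 : P[v | m] =ᵐ[P] 0) :
    P[v | m ⊔ MeasurableSpace.comap (ζ i) inferInstance] =ᵐ[P] 0 := by
  have hmi : MeasurableSpace.comap (ζ i) inferInstance ≤ m0 := (hζ i).comap_le
  have hmj : MeasurableSpace.comap (ζ j) inferInstance ≤ m0 := (hζ j).comap_le
  symm
  refine ae_eq_condExp_of_forall_setIntegral_eq (sup_le hm hmi) hv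
    (fun s _ _ => (integrable_zero Ω E P).integrableOn) (fun U hU _ => ?_)
    stronglyMeasurable_zero.aestronglyMeasurable
  refine setIntegral_eq_of_inter hm hmi (integrable_zero Ω E P) hv ?_ hU
  rintro S _ hS ⟨A, hA, rfl⟩
  have hAi : MeasurableSet (ζ i ⁻¹' A) := hζ i hA
  set a := (ζ i ⁻¹' A).indicator (fun _ => (1 : ℝ)) with ha
  have haint : Integrable a P := integrable_indicator_one hAi
  have hind : (fun ω => a ω • v ω) = (ζ i ⁻¹' A).indicator v := by
    ext ω
    by_cases hω : ω ∈ ζ i ⁻¹' A <;> simp [ha, hω]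
  have havint : Integrable (fun ω => a ω • v ω) P := by
    rw [hind]; exact hv.indicator hAi
  have ha1 : ∀ᵐ ω ∂P, ‖(P[a | m]) ω‖ ≤ 1 := by
    have := ae_bdd_abs_condExp_of_ae_bdd_abs (R := (1 : ℝ)) (m := m) (f := a) (μ := P)
      (Eventually.of_forall fun ω => by
        by_cases hω : ω ∈ ζ i ⁻¹' A <;> simp [ha, hω])
    simpa [Real.norm_eq_abs] using this
  have hcvint : Integrable (fun ω => (P[a | m]) ω • v ω) P :=
    hv.bdd_smul 1 (stronglyMeasurable_condExp.mono hm).aestronglyMeasurable ha1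
  -- Since `v` depends on `m` and `ζ j` only, the indicator `a` may be replaced by its conditional
  -- expectation given both, which is already `P[a | m]`.
  have key : ∫ ω in S, a ω • v ω ∂P = ∫ ω in S, (P[a | m]) ω • v ω ∂P := by
    have hS' : MeasurableSet[m ⊔ MeasurableSpace.comap (ζ j) inferInstance] S :=
      (le_sup_left : m ≤ _) S hS
    rw [← setIntegral_condExp (sup_le hm hmj) havint hS']
    refine setIntegral_congr_ae (hm S hS) ?_
    filter_upwards [condExp_smul_right_eq hvm havint haint,
      h.condExp_indicator_sup hm hζ hij hA] with ω h1 h2 _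
    rw [h1, ← h2]
  -- The weight is now `m`-measurable, so centering of `v` given `m` applies.
  have key2 : ∫ ω in S, (P[a | m]) ω • v ω ∂P = 0 := by
    rw [← setIntegral_condExp hm hcvint hS]
    have : ∀ᵐ ω ∂P, ω ∈ S → (P[fun ω => (P[a | m]) ω • v ω | m]) ω = (0 : E) := by
      filter_upwards [condExp_smul_left_eq stronglyMeasurable_condExp hcvint hv, hv0]
        with ω h1 h2 _
      rw [h1, h2, Pi.zero_apply, smul_zero]
    rw [setIntegral_congr_ae (hm S hS) this, integral_zero]
  rw [← setIntegral_indicator hAi, ← setIntegral_indicator hAi, ← hind, key, key2]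
  simp

end CondIndep

/-! ### Orthogonality of the noise in `L²`. -/

section Orthogonality

variable {Ω : Type*} {m : MeasurableSpace Ω} [m0 : MeasurableSpace Ω] {P : Measure Ω}
  {H : Type*} [NormedAddCommGroup H] [InnerProductSpace ℝ H]

lemma MeasureTheory.MemLp.integrable_inner_real {a b : Ω → H} (ha : MemLp a 2 P)
    (hb : MemLp b 2 P) : Integrable (fun ω => inner ℝ (a ω) (b ω)) P := by
  refine (ha.norm.integrable_mul hb.norm).mono (ha.1.inner hb.1) ?_
  refine Eventually.of_forall fun ω => ?_
  simpa using abs_real_inner_le_norm (a ω) (b ω)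

variable [IsProbabilityMeasure P] [CompleteSpace H]

lemma integral_inner_eq_zero (hm : m ≤ m0) {a v : Ω → H}
    (ha : MemLp a 2 P) (hv : MemLp v 2 P) (ham : StronglyMeasurable[m] a)
    (hv0 : P[v | m] =ᵐ[P] 0) : ∫ ω, inner ℝ (a ω) (v ω) ∂P = 0 := by
  have hint : Integrable (fun ω => inner ℝ (a ω) (v ω)) P := ha.integrable_inner_real hv
  have h := condExp_bilin_of_stronglyMeasurable_left (m := m) (μ := P) (innerSL ℝ (E := H))
    (f := a) (g := v) ham hint (hv.integrable (by norm_num))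
  rw [← integral_condExp hm]
  have h0 : P[fun ω => inner ℝ (a ω) (v ω) | m] =ᵐ[P] fun _ => (0 : ℝ) := by
    refine EventuallyEq.trans h ?_
    filter_upwards [hv0] with ω hω
    rw [hω]
    simp
  rw [integral_congr_ae h0, integral_zero]

/-- `w` stays centered after the sample of agent `i` is added to the conditioning, and then `v` is a
known factor. This removes the cross terms between the noises of different agents. -/
lemma CondIndepGiven.integral_inner_eq_zero {n : ℕ} {Ξ : Fin n → Type*}
    [∀ i, MeasurableSpace (Ξ i)] {ζ : ∀ i, Ω → Ξ i}
    (h : CondIndepGiven P m ζ) (hm : m ≤ m0)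
    (hζ : ∀ i, Measurable (ζ i)) {i j : Fin n} (hij : i ≠ j) {v w : Ω → H}
    (hv : MemLp v 2 P) (hw : MemLp w 2 P)
    (hvm : StronglyMeasurable[m ⊔ MeasurableSpace.comap (ζ i) inferInstance] v)
    (hwm : StronglyMeasurable[m ⊔ MeasurableSpace.comap (ζ j) inferInstance] w)
    (hw0 : P[w | m] =ᵐ[P] 0) : ∫ ω, inner ℝ (v ω) (w ω) ∂P = 0 :=
  _root_.integral_inner_eq_zero (sup_le hm (hζ i).comap_le) hv hw hvm
    (h.condExp_sup_eq_zero hm hζ hij (hw.integrable (by norm_num)) hwm hw0)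

end Orthogonality

/-! ### One step of the recursion in a single eigendirection. -/

section OneStep

variable {V : Type*} [NormedAddCommGroup V] [InnerProductSpace ℝ V]

/-- Here `a` is the linear part, `b` the noise and `c` the error. Young's inequality is used on `⟪a,
c⟫` only; `⟪a, b⟫` is kept exactly because it will vanish in expectation. -/
lemma norm_add_add_sq_le {r : ℝ} (hr : 0 < r) (hr1 : r < 1) (a b c : V) :
    ‖a + b + c‖ ^ 2 ≤ ‖a‖ ^ 2 / r + 2 * inner ℝ a b + 2 * ‖b‖ ^ 2 + 2 / (1 - r) * ‖c‖ ^ 2 := by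
  have h1 : 0 < 1 - r := sub_pos.2 hr1
  have e : ‖a + b + c‖ ^ 2 = ‖a‖ ^ 2 + 2 * inner ℝ a b + 2 * inner ℝ a c + ‖b + c‖ ^ 2 := by
    rw [add_assoc, norm_add_sq_real, inner_add_right]; ring
  have hbc : ‖b + c‖ ^ 2 ≤ 2 * ‖b‖ ^ 2 + 2 * ‖c‖ ^ 2 := by
    have := parallelogram_law_with_norm ℝ b c
    nlinarith [sq_nonneg ‖b - c‖]
  have hac : 2 * inner ℝ a c ≤ (1 - r) / r * ‖a‖ ^ 2 + r / (1 - r) * ‖c‖ ^ 2 := by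
    have h2 := real_inner_le_norm a c
    have h3 : (1 - r) / r * ‖a‖ ^ 2 + r / (1 - r) * ‖c‖ ^ 2 - 2 * (‖a‖ * ‖c‖)
        = ((1 - r) * ‖a‖ - r * ‖c‖) ^ 2 / (r * (1 - r)) := by
      field_simp; ring
    have h4 : 0 ≤ ((1 - r) * ‖a‖ - r * ‖c‖) ^ 2 / (r * (1 - r)) := by positivity
    linarith
  have e2 : (1 - r) / r * ‖a‖ ^ 2 = ‖a‖ ^ 2 / r - ‖a‖ ^ 2 := by field_simp
  have e3 : 2 / (1 - r) * ‖c‖ ^ 2 = r / (1 - r) * ‖c‖ ^ 2 + 2 * ‖c‖ ^ 2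
      + r / (1 - r) * ‖c‖ ^ 2 := by field_simp; ring
  have h5 : 0 ≤ r / (1 - r) * ‖c‖ ^ 2 := by positivity
  linarith

/-- One step of the recursion in an eigendirection of `W` with eigenvalue `t`: `p` is the
deviation from consensus, `q` the dual variable, `h` a gradient error, `v` the noise and `w` the
change of the reference gradient. -/
lemma mode_energy_step {t l α : ℝ} (ht : 0 < t) (htl : t ≤ l) (hl : l < 1) {p q h v w p' q' : V}
    (hp : p' = t • p - q - (α * t) • (h + v)) (hq : q' = q + (1 - t) • p' + (α * t) • w) :
    ‖p'‖ ^ 2 + ‖q'‖ ^ 2 / (t * (1 - t)) ≤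
      √l * (‖p‖ ^ 2 + ‖q‖ ^ 2 / (t * (1 - t))) - 2 * α * t * inner ℝ p v
        + 2 * α ^ 2 * l * ‖v‖ ^ 2
        + 4 * α ^ 2 * l / (1 - √l) * (‖h‖ ^ 2 + ‖w‖ ^ 2 / (1 - l)) := by
  have hl0 : 0 < l := ht.trans_le htl
  set r := √l with hr
  have hr0 : 0 < r := Real.sqrt_pos.2 hl0
  have hr1 : r < 1 := by rw [hr, Real.sqrt_lt' one_pos]; simpa using hl
  have hrl : r * r = l := Real.mul_self_sqrt hl0.le
  have ht1 : 0 < 1 - t := by linarith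
  have h1r : 0 < 1 - r := sub_pos.2 hr1
  have h1l : 0 < 1 - l := sub_pos.2 hl
  set s := t * (1 - t) with hs
  have hs0 : 0 < s := mul_pos ht ht1
  have ep : p' = (t • p - q) + (-(α * t)) • v + (-(α * t)) • h := by
    rw [hp]; module
  have eq : q' = (t • q + s • p) + (-(α * s)) • v + (α * t) • (w - (1 - t) • h) := by
    rw [hq, hp, hs]; module
  have b1 := norm_add_add_sq_le hr0 hr1 (t • p - q) ((-(α * t)) • v) ((-(α * t)) • h)
  have b2 := norm_add_add_sq_le hr0 hr1 (t • q + s • p) ((-(α * s)) • v)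
    ((α * t) • (w - (1 - t) • h))
  rw [← ep] at b1
  rw [← eq] at b2
  have n1 : ‖t • p - q‖ ^ 2 = t ^ 2 * ‖p‖ ^ 2 - 2 * t * inner ℝ p q + ‖q‖ ^ 2 := by
    rw [norm_sub_sq_real, norm_smul, real_inner_smul_left, mul_pow, Real.norm_eq_abs, sq_abs]
    ring
  have n2 : ‖t • q + s • p‖ ^ 2 = t ^ 2 * ‖q‖ ^ 2 + 2 * t * s * inner ℝ p q + s ^ 2 * ‖p‖ ^ 2 := by
    rw [norm_add_sq_real, norm_smul, norm_smul, real_inner_smul_left, real_inner_smul_right,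
      mul_pow, mul_pow, Real.norm_eq_abs, Real.norm_eq_abs, sq_abs, sq_abs, real_inner_comm p q]
    ring
  have n3 : ∀ (c : ℝ) (x : V), ‖c • x‖ ^ 2 = c ^ 2 * ‖x‖ ^ 2 := fun c x => by
    rw [norm_smul, mul_pow, Real.norm_eq_abs, sq_abs]
  have n4 : inner ℝ (t • p - q) ((-(α * t)) • v) = -(α * t) * (t * inner ℝ p v - inner ℝ q v) := by
    rw [real_inner_smul_right, inner_sub_left, real_inner_smul_left]
  have n5 : inner ℝ (t • q + s • p) ((-(α * s)) • v)
      = -(α * s) * (t * inner ℝ q v + s * inner ℝ p v) := by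
    rw [real_inner_smul_right, inner_add_left, real_inner_smul_left, real_inner_smul_left]
  have n6 : ‖w - (1 - t) • h‖ ^ 2 ≤ 2 * ‖w‖ ^ 2 + 2 * (1 - t) ^ 2 * ‖h‖ ^ 2 := by
    have := parallelogram_law_with_norm ℝ w ((1 - t) • h)
    have e := n3 (1 - t) h
    nlinarith [sq_nonneg ‖w + (1 - t) • h‖]
  rw [n1, n3, n3, n4] at b1
  rw [n2, n3, n3, n5] at b2
  have b2' : ‖q'‖ ^ 2 / s ≤ (t ^ 2 * ‖q‖ ^ 2 + 2 * t * s * inner ℝ p q + s ^ 2 * ‖p‖ ^ 2) / r / s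
      + 2 * (-α * (t * inner ℝ q v + s * inner ℝ p v)) + 2 * (α ^ 2 * s * ‖v‖ ^ 2)
      + 2 / (1 - r) * (α ^ 2 * t / (1 - t) * ‖w - (1 - t) • h‖ ^ 2) := by
    rw [div_le_iff₀ hs0]
    refine b2.trans_eq ?_
    have e : (α * t) ^ 2 = α ^ 2 * t / (1 - t) * s := by rw [hs]; field_simp
    rw [e]
    field_simp
  -- The weight `1/s` with `s = t(1-t)` is the one for which the `⟪p, q⟫` terms cancel. The
  -- remaining coefficients are `t² + s = t` and `1 + t²/s = t/s`, so the linear part contracts the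
  -- energy by exactly `t`.
  have c1 : (t ^ 2 * ‖p‖ ^ 2 - 2 * t * inner ℝ p q + ‖q‖ ^ 2) / r
      + (t ^ 2 * ‖q‖ ^ 2 + 2 * t * s * inner ℝ p q + s ^ 2 * ‖p‖ ^ 2) / r / s
      = t / r * (‖p‖ ^ 2 + ‖q‖ ^ 2 / s) := by
    rw [hs]; field_simp; ring
  -- With `r = √l`, the factor `t/r` is at most `l/√l = √l`.
  have c2 : t / r * (‖p‖ ^ 2 + ‖q‖ ^ 2 / s) ≤ r * (‖p‖ ^ 2 + ‖q‖ ^ 2 / s) := by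
    have : t / r ≤ r := by rw [div_le_iff₀ hr0, hrl]; exact htl
    gcongr
  have c3 : α ^ 2 * (t ^ 2 + s) * ‖v‖ ^ 2 ≤ α ^ 2 * l * ‖v‖ ^ 2 := by
    have : t ^ 2 + s ≤ l := by rw [hs]; linarith
    gcongr
  have c4 : (α * t) ^ 2 * ‖h‖ ^ 2 + α ^ 2 * t / (1 - t) * ‖w - (1 - t) • h‖ ^ 2
      ≤ 2 * α ^ 2 * l * (‖h‖ ^ 2 + ‖w‖ ^ 2 / (1 - l)) := by
    calc (α * t) ^ 2 * ‖h‖ ^ 2 + α ^ 2 * t / (1 - t) * ‖w - (1 - t) • h‖ ^ 2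
        ≤ (α * t) ^ 2 * ‖h‖ ^ 2
          + α ^ 2 * t / (1 - t) * (2 * ‖w‖ ^ 2 + 2 * (1 - t) ^ 2 * ‖h‖ ^ 2) := by gcongr
      _ = α ^ 2 * (t * (2 - t)) * ‖h‖ ^ 2 + 2 * α ^ 2 * t * (‖w‖ ^ 2 / (1 - t)) := by
          field_simp; ring
      _ ≤ α ^ 2 * (2 * l) * ‖h‖ ^ 2 + 2 * α ^ 2 * l * (‖w‖ ^ 2 / (1 - l)) := by
          have : t * (2 - t) ≤ 2 * l := by linarith [sq_nonneg t, mul_sub t 2 t, sq t]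
          gcongr
      _ = _ := by ring
  have c5 : 2 / (1 - r) * ((α * t) ^ 2 * ‖h‖ ^ 2
        + α ^ 2 * t / (1 - t) * ‖w - (1 - t) • h‖ ^ 2)
      ≤ 4 * α ^ 2 * l / (1 - r) * (‖h‖ ^ 2 + ‖w‖ ^ 2 / (1 - l)) := by
    calc _ ≤ 2 / (1 - r) * (2 * α ^ 2 * l * (‖h‖ ^ 2 + ‖w‖ ^ 2 / (1 - l))) := by gcongr
      _ = _ := by ring
  -- The same weight cancels the `⟪q, v⟫` terms, so the noise is paired with `p` alone.
  have c6 : 2 * (-(α * t) * (t * inner ℝ p v - inner ℝ q v))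
      + 2 * (-α * (t * inner ℝ q v + s * inner ℝ p v)) = - 2 * α * t * inner ℝ p v := by
    rw [hs]; ring
  have e7 : (-(α * t)) ^ 2 = (α * t) ^ 2 := by ring
  rw [e7] at b1
  have e8 : 2 * ((α * t) ^ 2 * ‖v‖ ^ 2) + 2 * (α ^ 2 * s * ‖v‖ ^ 2)
    = 2 * (α ^ 2 * (t ^ 2 + s) * ‖v‖ ^ 2) := by ring
  rw [mul_add (2 / (1 - r))] at c5
  linarith

end OneStep

/-! ### Deterministic trajectories: mean, modes and energy. -/

section Trajectory

variable {n d : ℕ}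

/-- Arithmetic mean of the vectors held by the agents. -/
def agentMean (x : Fin n → Vec d) : Vec d := (1 / (n : ℝ)) • ∑ i, x i

/-- Component of a stacked vector in the direction `a`. -/
def modal (a : Fin n → ℝ) (x : Fin n → Vec d) : Vec d := ∑ i, a i • x i

lemma modal_sub (a : Fin n → ℝ) (x y : Fin n → Vec d) :
    modal a (fun i => x i - y i) = modal a x - modal a y := by
  simp [modal, smul_sub]

lemma modal_add (a : Fin n → ℝ) (x y : Fin n → Vec d) :
    modal a (fun i => x i + y i) = modal a x + modal a y := by
  simp [modal, smul_add, Finset.sum_add_distrib]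

lemma modal_smul (a : Fin n → ℝ) (c : ℝ) (x : Fin n → Vec d) :
    modal a (fun i => c • x i) = c • modal a x := by
  simp only [modal, Finset.smul_sum]
  exact Finset.sum_congr rfl fun i _ => smul_comm _ _ _

lemma modal_const {a : Fin n → ℝ} (ha : ∑ i, a i = 0) (z : Vec d) :
    modal a (fun _ => z) = 0 := by
  rw [modal, ← Finset.sum_smul, ha, zero_smul]

lemma modal_mix (a : Fin n → ℝ) (B : Matrix (Fin n) (Fin n) ℝ) (x : Fin n → Vec d) :
    modal a (fun i => ∑ j, B i j • x j) = ∑ j, (∑ i, a i * B i j) • x j := by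
  simp only [modal, Finset.smul_sum, Finset.sum_smul, smul_smul]
  exact Finset.sum_comm

variable {W : Matrix (Fin n) (Fin n) ℝ} {l lmin : ℝ} {u : Fin n → Fin n → ℝ} {t : Fin n → ℝ}

lemma IsModalBasis.modal_mix (hu : IsModalBasis W l lmin u t) {j : Fin n} (hj : t j ≠ 0)
    (x : Fin n → Vec d) : modal (u j) (fun i => ∑ k, W i k • x k) = t j • modal (u j) x := by
  rw [_root_.modal_mix, modal, Finset.smul_sum]
  exact Finset.sum_congr rfl fun k _ => by rw [hu.eigen j hj, smul_smul]

lemma IsModalBasis.sum_modal_sq (hu : IsModalBasis W l lmin u t) (x : Fin n → Vec d) :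
    ∑ j, ‖modal (u j) x‖ ^ 2 = ∑ i, ‖x i‖ ^ 2 := hu.parseval x

lemma IsModalBasis.sum_modal_sq_le (hu : IsModalBasis W l lmin u t) (x : Fin n → Vec d)
    (s : Finset (Fin n)) : ∑ j ∈ s, ‖modal (u j) x‖ ^ 2 ≤ ∑ i, ‖x i‖ ^ 2 := by
  rw [← hu.sum_modal_sq]
  exact Finset.sum_le_sum_of_subset_of_nonneg (Finset.subset_univ _) fun _ _ _ => sq_nonneg _

/-- A trajectory of ED/D² with step size `α`, where `g k i` is the gradient used by agent `i` at
iteration `k`. -/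
structure IsEDTrajectory (W : Matrix (Fin n) (Fin n) ℝ) (α : ℝ) (x0 : Vec d)
    (g X : ℕ → Fin n → Vec d) : Prop where
  init : ∀ i, X 0 i = x0
  first : ∀ i, X 1 i = ∑ j, W i j • (X 0 j - α • g 0 j)
  step : ∀ k i, X (k + 2) i = ∑ j, W i j •
    ((2 : ℝ) • X (k + 1) j - X k j - α • (g (k + 1) j - g k j))

lemma agentMean_mix (hW : W ∈ doublyStochastic ℝ (Fin n)) (x : Fin n → Vec d) :
    agentMean (fun i => ∑ j, W i j • x j) = agentMean x := by
  have h := modal_mix (fun _ => (1 : ℝ)) W x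
  simp only [modal, one_smul, one_mul, sum_col_of_mem_doublyStochastic hW] at h
  rw [agentMean, agentMean, h]

lemma agentMean_sub (x y : Fin n → Vec d) :
    agentMean (fun i => x i - y i) = agentMean x - agentMean y := by
  simp [agentMean, smul_sub]

lemma agentMean_smul (c : ℝ) (x : Fin n → Vec d) :
    agentMean (fun i => c • x i) = c • agentMean x := by
  rw [agentMean, agentMean, ← Finset.smul_sum, smul_comm]

lemma agentMean_const (hn : 0 < n) (z : Vec d) : agentMean (fun _ : Fin n => z) = z := by
  have hn' : (n : ℝ) ≠ 0 := by exact_mod_cast hn.ne'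
  rw [agentMean, Finset.sum_const, Finset.card_univ, Fintype.card_fin,
    ← Nat.cast_smul_eq_nsmul ℝ, smul_smul, one_div, inv_mul_cancel₀ hn', one_smul]

variable {α : ℝ} {x0 : Vec d} {g X : ℕ → Fin n → Vec d}

/-- Mixing preserves the mean, and the second-order recursion for the means telescopes to gradient
descent because the first step already has that form. -/
lemma IsEDTrajectory.agentMean_succ (hX : IsEDTrajectory W α x0 g X)
    (hW : W ∈ doublyStochastic ℝ (Fin n)) (k : ℕ) :
    agentMean (X (k + 1)) = agentMean (X k) - α • agentMean (g k) := by
  induction k with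
  | zero =>
    have h : X 1 = fun i => ∑ j, W i j • (X 0 j - α • g 0 j) := funext hX.first
    rw [zero_add, h, agentMean_mix hW, agentMean_sub, agentMean_smul]
  | succ k ih =>
    have h : X (k + 1 + 1) = fun i => ∑ j, W i j •
      ((2 : ℝ) • X (k + 1) j - X k j - α • (g (k + 1) j - g k j)) := funext (hX.step k)
    rw [h, agentMean_mix hW, agentMean_sub, agentMean_sub, agentMean_smul, agentMean_smul,
      agentMean_sub, ih]
    module

/-- The dual variable in the direction `a` for the eigenvalue `s`. -/
def modalDual (a : Fin n → ℝ) (s : ℝ) (X : ℕ → Fin n → Vec d) (k : ℕ) : Vec d :=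
  (1 - s) • ∑ r ∈ Finset.range k, modal a (X (r + 1))

lemma modalDual_succ (a : Fin n → ℝ) (s : ℝ) (k : ℕ) :
    modalDual a s X (k + 1) = modalDual a s X k + (1 - s) • modal a (X (k + 1)) := by
  rw [modalDual, modalDual, Finset.sum_range_succ, smul_add]

/-- The second-order recursion is the difference of two consecutive instances of this first-order
one, the running sum being its integrator. The sum is empty at `k = 0`, where the formula is the
special first step of the algorithm. -/
lemma IsEDTrajectory.modal_succ (hX : IsEDTrajectory W α x0 g X)
    (hu : IsModalBasis W l lmin u t) {j : Fin n} (hj : t j ≠ 0) (k : ℕ) :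
    modal (u j) (X (k + 1)) = t j • modal (u j) (X k) - modalDual (u j) (t j) X k
      - (α * t j) • modal (u j) (g k) := by
  induction k with
  | zero =>
    have h : X 1 = fun i => ∑ j, W i j • (X 0 j - α • g 0 j) := funext hX.first
    rw [zero_add, h, hu.modal_mix hj, modal_sub, modal_smul, modalDual, Finset.range_zero,
      Finset.sum_empty]
    module
  | succ k ih =>
    have h : X (k + 1 + 1) = fun i => ∑ j, W i j •
      ((2 : ℝ) • X (k + 1) j - X k j - α • (g (k + 1) j - g k j)) := funext (hX.step k)
    have e : modalDual (u j) (t j) X k = t j • modal (u j) (X k)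
      - (α * t j) • modal (u j) (g k) - modal (u j) (X (k + 1)) := by
      rw [ih]; abel
    rw [h, hu.modal_mix hj, modal_sub, modal_sub, modal_smul, modal_smul, modal_sub,
      modalDual_succ, e]
    module

/-- Every iterate after the start has the form `W y`, so its deviation from the mean is `(W - 𝟙𝟙ᵀ/n)
y`, which has no component in a null mode; at the start the deviation is zero. Hence the energy may
ignore these modes. -/
lemma IsEDTrajectory.modal_dev_null (hX : IsEDTrajectory W α x0 g X) (hn : 0 < n)
    (hW : W ∈ doublyStochastic ℝ (Fin n))
    (hu : IsModalBasis W l lmin u t) {j : Fin n} (hj : t j = 0) (k : ℕ) :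
    modal (u j) (fun i => X k i - agentMean (X k)) = 0 := by
  have key : ∀ y : Fin n → Vec d, (∀ i, X k i = ∑ m, W i m • y m) →
      modal (u j) (fun i => X k i - agentMean (X k)) = 0 := fun y hy => by
    have h1 : X k = fun i => ∑ m, W i m • y m := funext hy
    have h2 : agentMean (X k) = agentMean y := by rw [h1, agentMean_mix hW]
    have h3 : (fun i => X k i - agentMean (X k))
        = fun i => ∑ m, (W - Matrix.of (fun _ _ : Fin n => 1 / (n : ℝ))) i m • y m := by
      ext1 i
      rw [h2, hy i, agentMean, Finset.smul_sum, ← Finset.sum_sub_distrib]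
      exact Finset.sum_congr rfl fun m _ => by
        rw [← sub_smul]; rfl
    rw [h3, _root_.modal_mix]
    refine Finset.sum_eq_zero fun m _ => ?_
    have := hu.null j hj m
    simp only [Matrix.sub_apply, Matrix.of_apply]
    rw [this, zero_smul]
  rcases k with _ | _ | k
  · have h1 : X 0 = fun _ => x0 := funext hX.init
    rw [h1, agentMean_const hn]
    simp [modal]
  · exact key _ hX.first
  · exact key _ (hX.step k)

/-- The squared norm of the transformed state: deviation from consensus plus the weighted
deviation of the dual variable from its target for the reference gradients `c`. -/
def energy (α : ℝ) (u : Fin n → Fin n → ℝ) (t : Fin n → ℝ) (X : ℕ → Fin n → Vec d)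
    (c : Fin n → Vec d) (k : ℕ) : ℝ :=
  ∑ j with t j ≠ 0, (‖modal (u j) (X k)‖ ^ 2
    + ‖modalDual (u j) (t j) X k + (α * t j) • modal (u j) c‖ ^ 2 / (t j * (1 - t j)))

lemma IsModalBasis.pos (hu : IsModalBasis W l lmin u t) {j : Fin n} (hj : t j ≠ 0) : 0 < t j :=
  lt_of_le_of_ne (hu.nonneg j) hj.symm

lemma IsModalBasis.energy_nonneg (hu : IsModalBasis W l lmin u t) (hl : l < 1)
    (c : Fin n → Vec d) (k : ℕ) : 0 ≤ energy α u t X c k := by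
  refine Finset.sum_nonneg fun j _ => ?_
  have h1 := hu.nonneg j
  have h2 : 0 ≤ 1 - t j := by linarith [hu.le j]
  positivity

lemma IsEDTrajectory.sum_dev_sq_le_energy (hX : IsEDTrajectory W α x0 g X) (hn : 0 < n)
    (hW : W ∈ doublyStochastic ℝ (Fin n)) (hu : IsModalBasis W l lmin u t) (hl : l < 1)
    (c : Fin n → Vec d) (k : ℕ) :
    ∑ i, ‖X k i - agentMean (X k)‖ ^ 2 ≤ energy α u t X c k := by
  rw [← hu.sum_modal_sq, energy, Finset.sum_filter]
  refine Finset.sum_le_sum fun j _ => ?_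
  split_ifs with hj
  · rw [modal_sub, modal_const (hu.sum_eq_zero j hj), sub_zero]
    have h1 := hu.nonneg j
    have h2 : 0 ≤ 1 - t j := by linarith [hu.le j]
    have : 0 ≤ ‖modalDual (u j) (t j) X k + (α * t j) • modal (u j) c‖ ^ 2
      / (t j * (1 - t j)) := by positivity
    linarith
  · rw [hX.modal_dev_null hn hW hu (not_not.1 hj)]
    simp

/-- Starting at a common point leaves only the dual part `α t · modal c`, which is `α` times the
mode of `W c`. The modes kill constants, so any `z` may be subtracted, and `t(1-t) ≥ lmin(1-l)`. -/
lemma IsEDTrajectory.energy_zero_le (hX : IsEDTrajectory W α x0 g X)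
    (hu : IsModalBasis W l lmin u t) (hl : l < 1) (hlmin : 0 < lmin)
    (c : Fin n → Vec d) (z : Vec d) :
    energy α u t X c 0 ≤ α ^ 2 / ((1 - l) * lmin) * ∑ i, ‖∑ j, W i j • c j - z‖ ^ 2 := by
  have h1l : 0 < 1 - l := sub_pos.2 hl
  refine le_trans ?_ (mul_le_mul_of_nonneg_left (hu.sum_modal_sq_le
    (fun i => ∑ j, W i j • c j - z) {j | t j ≠ 0}) (by positivity))
  rw [energy, Finset.mul_sum]
  refine Finset.sum_le_sum fun j hj => ?_
  have hj' : t j ≠ 0 := by simpa using hj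
  have h0 : X 0 = fun _ => x0 := funext hX.init
  rw [h0, modal_const (hu.sum_eq_zero j hj'), modalDual, Finset.range_zero, Finset.sum_empty,
    smul_zero, zero_add, norm_zero, modal_sub, modal_const (hu.sum_eq_zero j hj'), sub_zero,
    hu.modal_mix hj', mul_smul, norm_smul, mul_pow, Real.norm_eq_abs, sq_abs]
  have ht := hu.pos hj'
  have h1 := hu.lmin_le j hj'
  have h2 := hu.le j
  have h3 : (1 - l) * lmin ≤ t j * (1 - t j) := by
    rw [mul_comm]
    exact mul_le_mul h1 (by linarith) h1l.le ht.le
  have h4 : 0 < (1 - l) * lmin := by positivity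
  calc 0 ^ 2 + α ^ 2 * ‖t j • modal (u j) c‖ ^ 2 / (t j * (1 - t j))
      = α ^ 2 * ‖t j • modal (u j) c‖ ^ 2 / (t j * (1 - t j)) := by ring
    _ ≤ α ^ 2 * ‖t j • modal (u j) c‖ ^ 2 / ((1 - l) * lmin) := by gcongr
    _ = _ := by ring

/-- The mode-wise inequality is summed, with the gradient split into reference `c`, error `h` and
noise `v`. The noise term is rewritten as a sum over agents so that the centering of each agent's
noise can be applied to it. -/
lemma IsEDTrajectory.energy_succ_le (hX : IsEDTrajectory W α x0 g X)
    (hu : IsModalBasis W l lmin u t) (hl0 : 0 ≤ l) (hl : l < 1) (k : ℕ)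
    (c c' h v : Fin n → Vec d) (hg : ∀ i, g k i = c i + h i + v i) :
    energy α u t X c' (k + 1) ≤ √l * energy α u t X c k
      - 2 * α * ∑ i, inner ℝ (∑ j with t j ≠ 0, (t j * u j i) • modal (u j) (X k)) (v i)
      + 2 * α ^ 2 * l * ∑ i, ‖v i‖ ^ 2
      + 4 * α ^ 2 * l / (1 - √l) * (∑ i, ‖h i‖ ^ 2 + (∑ i, ‖c' i - c i‖ ^ 2) / (1 - l)) := by
  have h1l : 0 < 1 - l := sub_pos.2 hl
  have h1r : 0 < 1 - √l := by
    rw [sub_pos, Real.sqrt_lt' one_pos]; simpa using hl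
  have hcross : ∑ i, inner ℝ (∑ j with t j ≠ 0, (t j * u j i) • modal (u j) (X k)) (v i)
      = ∑ j with t j ≠ 0, t j * inner ℝ (modal (u j) (X k)) (modal (u j) v) := by
    simp_rw [sum_inner]
    rw [Finset.sum_comm]
    refine Finset.sum_congr rfl fun j _ => ?_
    rw [show modal (u j) v = ∑ i, u j i • v i from rfl, inner_sum, Finset.mul_sum]
    refine Finset.sum_congr rfl fun i _ => ?_
    rw [real_inner_smul_left, real_inner_smul_right]
    ring
  have hgk : g k = fun i => (c i + h i) + v i := funext hg
  have step : ∀ j ∈ ({j | t j ≠ 0} : Finset (Fin n)),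
      ‖modal (u j) (X (k + 1))‖ ^ 2
        + ‖modalDual (u j) (t j) X (k + 1) + (α * t j) • modal (u j) c'‖ ^ 2 / (t j * (1 - t j))
      ≤ √l * (‖modal (u j) (X k)‖ ^ 2
        + ‖modalDual (u j) (t j) X k + (α * t j) • modal (u j) c‖ ^ 2 / (t j * (1 - t j)))
        - 2 * α * (t j * inner ℝ (modal (u j) (X k)) (modal (u j) v))
        + 2 * α ^ 2 * l * ‖modal (u j) v‖ ^ 2
        + 4 * α ^ 2 * l / (1 - √l) * (‖modal (u j) h‖ ^ 2
          + ‖modal (u j) (fun i => c' i - c i)‖ ^ 2 / (1 - l)) := by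
    intro j hj
    have hj' : t j ≠ 0 := by simpa using hj
    have := mode_energy_step (α := α) (hu.pos hj') (hu.le j) hl
      (p := modal (u j) (X k)) (q := modalDual (u j) (t j) X k + (α * t j) • modal (u j) c)
      (h := modal (u j) h) (v := modal (u j) v) (w := modal (u j) (fun i => c' i - c i))
      (p' := modal (u j) (X (k + 1)))
      (q' := modalDual (u j) (t j) X (k + 1) + (α * t j) • modal (u j) c')
      (by rw [hX.modal_succ hu hj', hgk, modal_add, modal_add]; module)
      (by rw [modalDual_succ, modal_sub]; module)
    linarith
  have hsum := Finset.sum_le_sum step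
  simp only [Finset.sum_add_distrib, Finset.sum_sub_distrib, ← Finset.mul_sum,
    ← Finset.sum_div] at hsum
  rw [hcross]
  have s1 := hu.sum_modal_sq_le v {j | t j ≠ 0}
  have s2 := hu.sum_modal_sq_le h {j | t j ≠ 0}
  have s3 := hu.sum_modal_sq_le (fun i => c' i - c i) {j | t j ≠ 0}
  have s4 : 2 * α ^ 2 * l * ∑ j with t j ≠ 0, ‖modal (u j) v‖ ^ 2
      ≤ 2 * α ^ 2 * l * ∑ i, ‖v i‖ ^ 2 := by gcongr
  have s5 : 4 * α ^ 2 * l / (1 - √l) * (∑ j with t j ≠ 0, ‖modal (u j) h‖ ^ 2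
        + (∑ j with t j ≠ 0, ‖modal (u j) (fun i => c' i - c i)‖ ^ 2) / (1 - l))
      ≤ 4 * α ^ 2 * l / (1 - √l)
        * (∑ i, ‖h i‖ ^ 2 + (∑ i, ‖c' i - c i‖ ^ 2) / (1 - l)) := by gcongr
  simp only [energy, Finset.sum_add_distrib]
  linarith

end Trajectory

/-! ### Pathwise inequalities for gradients of smooth costs. -/

section Pathwise

variable {n d : ℕ} {W : Matrix (Fin n) (Fin n) ℝ} {l lmin : ℝ} {u : Fin n → Fin n → ℝ}
  {t : Fin n → ℝ} {α L : ℝ} {x0 : Vec d} {g X : ℕ → Fin n → Vec d} {f : Fin n → Vec d → ℝ}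

lemma sum_gradient_sub_sq_le (hf : ∀ i, IsLSmooth L (f i)) (x y : Fin n → Vec d) :
    ∑ i, ‖gradient (f i) (x i) - gradient (f i) (y i)‖ ^ 2
      ≤ L ^ 2 * ∑ i, ‖x i - y i‖ ^ 2 := by
  rw [Finset.mul_sum]
  refine Finset.sum_le_sum fun i _ => ?_
  rw [← mul_pow]
  exact pow_le_pow_left₀ (norm_nonneg _) ((hf i).2 _ _) 2

lemma agentMean_add (x y : Fin n → Vec d) :
    agentMean (fun i => x i + y i) = agentMean x + agentMean y := by
  simp [agentMean, Finset.sum_add_distrib]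

/-- The reference gradients are taken at the mean iterate. The error is then controlled by the
energy itself, and the drift of the reference by one step of the mean, which is of order `α`; hence
the factor `α⁴` in the last term. -/
lemma IsEDTrajectory.energy_gradient_step (hX : IsEDTrajectory W α x0 g X) (hn : 0 < n)
    (hW : W ∈ doublyStochastic ℝ (Fin n)) (hu : IsModalBasis W l lmin u t) (hl0 : 0 ≤ l)
    (hl : l < 1) (hf : ∀ i, IsLSmooth L (f i)) (k : ℕ) (v : Fin n → Vec d)
    (hg : ∀ i, g k i = gradient (f i) (X k i) + v i) :
    energy α u t X (fun i => gradient (f i) (agentMean (X (k + 1)))) (k + 1) ≤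
      (√l + 4 * α ^ 2 * L ^ 2 * l / (1 - √l))
        * energy α u t X (fun i => gradient (f i) (agentMean (X k))) k
      - 2 * α * ∑ i, inner ℝ (∑ j with t j ≠ 0, (t j * u j i) • modal (u j) (X k)) (v i)
      + 2 * α ^ 2 * l * ∑ i, ‖v i‖ ^ 2
      + 4 * α ^ 4 * L ^ 2 * l / ((1 - √l) * (1 - l)) * n *
        ‖agentMean (fun i => gradient (f i) (X k i)) + agentMean v‖ ^ 2 := by
  have h1l : 0 < 1 - l := sub_pos.2 hl
  have h1r : 0 < 1 - √l := by
    rw [sub_pos, Real.sqrt_lt' one_pos]; simpa using hl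
  have h := hX.energy_succ_le hu hl0 hl k (fun i => gradient (f i) (agentMean (X k)))
    (fun i => gradient (f i) (agentMean (X (k + 1))))
    (fun i => gradient (f i) (X k i) - gradient (f i) (agentMean (X k))) v
    (fun i => by rw [hg]; abel)
  have h1 : ∑ i, ‖gradient (f i) (X k i) - gradient (f i) (agentMean (X k))‖ ^ 2
      ≤ L ^ 2 * energy α u t X (fun i => gradient (f i) (agentMean (X k))) k :=
    (sum_gradient_sub_sq_le hf _ _).trans
      (mul_le_mul_of_nonneg_left (hX.sum_dev_sq_le_energy hn hW hu hl _ k) (sq_nonneg L))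
  have hgk : g k = fun i => gradient (f i) (X k i) + v i := funext hg
  have h2 : ∑ i, ‖gradient (f i) (agentMean (X (k + 1)))
      - gradient (f i) (agentMean (X k))‖ ^ 2
      ≤ L ^ 2 * (n * (α ^ 2 *
        ‖agentMean (fun i => gradient (f i) (X k i)) + agentMean v‖ ^ 2)) := by
    refine (sum_gradient_sub_sq_le hf _ _).trans_eq ?_
    rw [hX.agentMean_succ hW, hgk, agentMean_add, sub_sub_cancel_left, norm_neg, norm_smul,
      mul_pow, Real.norm_eq_abs, sq_abs, Finset.sum_const, Finset.card_univ, Fintype.card_fin,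
      nsmul_eq_mul]
  refine h.trans ?_
  have h3 : 4 * α ^ 2 * l / (1 - √l)
      * (∑ i, ‖gradient (f i) (X k i) - gradient (f i) (agentMean (X k))‖ ^ 2
        + (∑ i, ‖gradient (f i) (agentMean (X (k + 1)))
          - gradient (f i) (agentMean (X k))‖ ^ 2) / (1 - l))
      ≤ 4 * α ^ 2 * l / (1 - √l)
      * (L ^ 2 * energy α u t X (fun i => gradient (f i) (agentMean (X k))) k
        + L ^ 2 * (n * (α ^ 2 *
        ‖agentMean (fun i => gradient (f i) (X k i)) + agentMean v‖ ^ 2)) / (1 - l)) := by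
    gcongr
  refine (add_le_add_right h3 _).trans_eq ?_
  field_simp
  ring

/-- Polarizing `⟪∇f, m⟫`, with `m` the mean of the local gradients, keeps the term `-α/2 ‖m‖²`,
which later absorbs every contribution of `m`. -/
lemma IsEDTrajectory.descent_step (hX : IsEDTrajectory W α x0 g X) (hn : 0 < n) (hα : 0 ≤ α)
    (hW : W ∈ doublyStochastic ℝ (Fin n)) (hu : IsModalBasis W l lmin u t)
    (hl : l < 1) (hf : ∀ i, IsLSmooth L (f i)) (k : ℕ) (v c : Fin n → Vec d)
    (hg : ∀ i, g k i = gradient (f i) (X k i) + v i) :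
    aggregate f (agentMean (X (k + 1))) ≤ aggregate f (agentMean (X k))
      - α / 2 * ‖gradient (aggregate f) (agentMean (X k))‖ ^ 2
      - α / 2 * ‖agentMean (fun i => gradient (f i) (X k i))‖ ^ 2
      + α * L ^ 2 / (2 * n) * energy α u t X c k
      - α * inner ℝ (gradient (aggregate f) (agentMean (X k))) (agentMean v)
      + L * α ^ 2 / 2 * ‖agentMean (fun i => gradient (f i) (X k i)) + agentMean v‖ ^ 2 := by
  have hgk : g k = fun i => gradient (f i) (X k i) + v i := funext hg
  have h := (isLSmooth_aggregate hn hf).le_quadratic (agentMean (X k)) (agentMean (X (k + 1)))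
  rw [hX.agentMean_succ hW, hgk, agentMean_add, sub_sub_cancel_left, norm_neg, norm_smul,
    mul_pow, Real.norm_eq_abs, sq_abs, inner_neg_right, inner_smul_right, inner_add_right,
    ← agentMean_add, ← hgk, ← hX.agentMean_succ hW, hgk, agentMean_add] at h
  set m := agentMean (fun i => gradient (f i) (X k i)) with hm
  set y := gradient (aggregate f) (agentMean (X k)) with hy
  have h1 : ‖y - m‖ ^ 2 ≤ L ^ 2 / n * energy α u t X c k := by
    have e : y - m = (1 / (n : ℝ)) • ∑ i, (gradient (f i) (agentMean (X k))
        - gradient (f i) (X k i)) := by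
      rw [hy, gradient_aggregate hf, Finset.sum_sub_distrib, smul_sub]
      rfl
    rw [e]
    refine (norm_mean_sq_le _).trans ?_
    have h2 := sum_gradient_sub_sq_le hf (fun _ => agentMean (X k)) (X k)
    simp only [norm_sub_rev (agentMean (X k))] at h2
    have h3 := hX.sum_dev_sq_le_energy hn hW hu hl c k
    calc _ ≤ 1 / (n : ℝ) * (L ^ 2 * energy α u t X c k) := by
          gcongr
          exact h2.trans (by gcongr)
      _ = _ := by ring
  have h4 : inner ℝ y m = (‖y‖ ^ 2 + ‖m‖ ^ 2 - ‖y - m‖ ^ 2) / 2 := by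
    rw [norm_sub_sq_real]; ring
  have h5 : α / 2 * ‖y - m‖ ^ 2 ≤ α / 2 * (L ^ 2 / n * energy α u t X c k) := by gcongr
  have h6 : α / 2 * (L ^ 2 / n * energy α u t X c k)
    = α * L ^ 2 / (2 * n) * energy α u t X c k := by field_simp
  rw [h4] at h
  linarith

end Pathwise

/-! ### The stochastic iterates as trajectories. -/

section Iterates

variable {n d : ℕ} {Ω : Type*} {Ξ : Fin n → Type*} {W : Matrix (Fin n) (Fin n) ℝ} {α : ℝ}
  {G : ∀ i, Vec d → Ξ i → Vec d} {ξ : ℕ → ∀ i, Ω → Ξ i} {x0 : Vec d}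

lemma isEDTrajectory_edIterate (ω : Ω) :
    IsEDTrajectory W α x0 (fun k i => G i (edIterate W α G ξ x0 k ω i) (ξ k i ω))
      (fun k => edIterate W α G ξ x0 k ω) where
  init _ := by simp only [edIterate]
  first _ := by simp only [edIterate]
  step _ _ := by simp only [edIterate]

/-- A property of random vectors that is stable under linear combinations and under passing from
an iterate to its stochastic gradient holds for all iterates. -/
lemma edIterate_induction {Q : (Ω → Vec d) → Prop} (const : ∀ c, Q fun _ => c)
    (sub : ∀ Y Z, Q Y → Q Z → Q fun ω => Y ω - Z ω) (smul : ∀ (c : ℝ) Y, Q Y → Q fun ω => c • Y ω)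
    (sum : ∀ Y : Fin n → Ω → Vec d, (∀ j, Q (Y j)) → Q fun ω => ∑ j, Y j ω)
    (grad : ∀ k i, Q (fun ω => edIterate W α G ξ x0 k ω i) →
      Q fun ω => G i (edIterate W α G ξ x0 k ω i) (ξ k i ω)) (k : ℕ) (i : Fin n) :
    Q fun ω => edIterate W α G ξ x0 k ω i := by
  have h0 : ∀ i, Q (fun ω => edIterate W α G ξ x0 0 ω i) := fun i => by
    simp only [edIterate]; exact const x0
  -- The recursion has order two, so the induction carries two consecutive iterates.
  suffices h : ∀ k, (∀ i, Q (fun ω => edIterate W α G ξ x0 k ω i)) ∧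
      ∀ i, Q (fun ω => edIterate W α G ξ x0 (k + 1) ω i) from (h k).1 i
  intro k
  induction k with
  | zero =>
    refine ⟨h0, fun i => ?_⟩
    rw [show (fun ω => edIterate W α G ξ x0 (0 + 1) ω i) = _ from
      funext fun ω => (isEDTrajectory_edIterate ω).first i]
    exact sum _ fun j => smul _ _ (sub _ _ (h0 j) (smul _ _ (grad 0 j (h0 j))))
  | succ k ih =>
    refine ⟨ih.2, fun i => ?_⟩
    rw [show (fun ω => edIterate W α G ξ x0 (k + 1 + 1) ω i) = _ from
      funext fun ω => (isEDTrajectory_edIterate ω).step k i]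
    exact sum _ fun j => smul _ _ (sub _ _ (sub _ _ (smul _ _ (ih.2 j)) (ih.1 j))
      (smul _ _ (sub _ _ (grad (k + 1) j (ih.2 j)) (grad k j (ih.1 j)))))

lemma grad_eq_add_gradNoise {f : Fin n → Vec d → ℝ} (k : ℕ) (i : Fin n) (ω : Ω) :
    G i (edIterate W α G ξ x0 k ω i) (ξ k i ω)
      = gradient (f i) (edIterate W α G ξ x0 k ω i)
        + gradNoise f G ξ (edIterate W α G ξ x0) k i ω := by
  rw [gradNoise]; abel

lemma measurable_pastSigma {X : ℕ → Ω → Fin n → Vec d} {r k : ℕ} (hr : r ≤ k) (i : Fin n) :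
    Measurable[pastSigma X k] (fun ω => X r ω i) := by
  have h1 : MeasurableSpace.comap (X r) inferInstance ≤ pastSigma X k :=
    le_iSup₂ (f := fun t (_ : t ∈ Finset.range (k + 1)) =>
      MeasurableSpace.comap (X t) inferInstance) r (Finset.mem_range.2 (by omega))
  have h2 : Measurable[pastSigma X k] (X r) := fun s hs => h1 _ ⟨s, hs, rfl⟩
  exact (measurable_pi_apply i).comp h2

end Iterates

/-! ### Measurability, integrability and moments of the noise. -/

section Stochastic

variable {n d : ℕ} {Ω : Type*} [m0 : MeasurableSpace Ω] {Ξ : Fin n → Type*}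
  [∀ i, MeasurableSpace (Ξ i)] {P : Measure Ω}
  {W : Matrix (Fin n) (Fin n) ℝ} {α L σ : ℝ} {f : Fin n → Vec d → ℝ}
  {G : ∀ i, Vec d → Ξ i → Vec d} {ξ : ℕ → ∀ i, Ω → Ξ i} {x0 : Vec d}

/-- Standing assumptions on a run of stochastic ED/D². -/
structure IsStochasticED (P : Measure Ω) (W : Matrix (Fin n) (Fin n) ℝ) (α L σ : ℝ)
    (f : Fin n → Vec d → ℝ) (G : ∀ i, Vec d → Ξ i → Vec d) (ξ : ℕ → ∀ i, Ω → Ξ i)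
    (x0 : Vec d) : Prop where
  agents_pos : 0 < n
  lipschitz_pos : 0 < L
  stochastic : W ∈ doublyStochastic ℝ (Fin n)
  smooth : ∀ i, IsLSmooth L (f i)
  measurable_grad : ∀ i, Measurable (fun p : Vec d × Ξ i => G i p.1 p.2)
  measurable_sample : ∀ k i, Measurable (ξ k i)
  noise : NoiseAssumption P f G ξ (edIterate W α G ξ x0) σ

lemma pastSigma_le {X : ℕ → Ω → Fin n → Vec d} (hX : ∀ k i, Measurable (fun ω => X k ω i))
    (k : ℕ) : pastSigma X k ≤ m0 :=
  iSup₂_le fun r _ => (measurable_pi_iff.2 (hX r)).comap_le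

namespace IsStochasticED

lemma measurable_iterate (S : IsStochasticED P W α L σ f G ξ x0) (k : ℕ) (i : Fin n) :
    Measurable (fun ω => edIterate W α G ξ x0 k ω i) :=
  edIterate_induction (Q := Measurable) (fun _ => measurable_const)
    (fun _ _ hY hZ => hY.sub hZ) (fun c _ hY => hY.const_smul c)
    (fun _ hY => Finset.measurable_fun_sum _ fun j _ => hY j)
    (fun k i hk => (S.measurable_grad i).comp (hk.prodMk (S.measurable_sample k i))) k i

lemma pastSigma_le (S : IsStochasticED P W α L σ f G ξ x0) (k : ℕ) :
    pastSigma (edIterate W α G ξ x0) k ≤ m0 :=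
  _root_.pastSigma_le S.measurable_iterate k

/-- The noise is a function of the past and of the agent's own sample. -/
lemma stronglyMeasurable_noise (S : IsStochasticED P W α L σ f G ξ x0) (k : ℕ) (i : Fin n) :
    StronglyMeasurable[pastSigma (edIterate W α G ξ x0) k
      ⊔ MeasurableSpace.comap (ξ k i) inferInstance]
      (gradNoise f G ξ (edIterate W α G ξ x0) k i) := by
  have h1 : Measurable[pastSigma (edIterate W α G ξ x0) k
      ⊔ MeasurableSpace.comap (ξ k i) inferInstance]
      (fun ω => edIterate W α G ξ x0 k ω i) :=
    (measurable_pastSigma le_rfl i).mono le_sup_left le_rfl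
  have h2 : Measurable[pastSigma (edIterate W α G ξ x0) k
      ⊔ MeasurableSpace.comap (ξ k i) inferInstance] (ξ k i) :=
    (comap_measurable (ξ k i)).mono le_sup_right le_rfl
  have h3 := (S.measurable_grad i).comp (h1.prodMk h2)
  have h4 := ((S.smooth i).continuous_gradient S.lipschitz_pos.le).measurable.comp h1
  exact Measurable.stronglyMeasurable (h3.sub h4)

end IsStochasticED

lemma memLp_agentMean {Y : Ω → Fin n → Vec d} (hY : ∀ i, MemLp (fun ω => Y ω i) 2 P) :
    MemLp (fun ω => agentMean (Y ω)) 2 P :=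
  (memLp_finsetSum Finset.univ fun i _ => hY i).const_smul (1 / (n : ℝ))

variable [IsProbabilityMeasure P]

lemma memLp_gradient {g : Vec d → ℝ} (hg : IsLSmooth L g) (hL : 0 ≤ L) {Y : Ω → Vec d}
    (hY : MemLp Y 2 P) : MemLp (fun ω => gradient g (Y ω)) 2 P := by
  refine MemLp.of_le ((memLp_const ‖gradient g 0‖).add (hY.norm.const_mul L))
    ((hg.continuous_gradient hL).comp_aestronglyMeasurable hY.1) (Eventually.of_forall fun ω => ?_)
  have h := hg.2 (Y ω) 0
  rw [sub_zero] at h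
  have h2 := norm_le_norm_add_norm_sub' (gradient g (Y ω)) (gradient g 0)
  refine le_trans ?_ (le_abs_self _)
  simp only [Pi.add_apply]
  linarith

/-- `g` lies between a constant and a quadratic, and `Y` is square integrable. -/
lemma IsLSmooth.integrable_comp {g : Vec d → ℝ} (hg : IsLSmooth L g) (hL : 0 < L) {gstar : ℝ}
    (hstar : ∀ x, gstar ≤ g x) {Y : Ω → Vec d} (hY : MemLp Y 2 P) :
    Integrable (fun ω => g (Y ω)) P := by
  have hb : Integrable (fun ω => |gstar| + |g 0| + ‖gradient g 0‖ * ‖Y ω‖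
      + L / 2 * ‖Y ω‖ ^ 2) P :=
    ((integrable_const _).add ((hY.integrable (by norm_num)).norm.const_mul _)).add
      (hY.norm.integrable_sq.const_mul _)
  refine hb.mono (hg.1.continuous.comp_aestronglyMeasurable hY.1) (Eventually.of_forall fun ω => ?_)
  refine le_trans ?_ (le_abs_self _)
  have h1 := hg.le_quadratic 0 (Y ω)
  rw [sub_zero] at h1
  have h2 := hstar (Y ω)
  have h3 := real_inner_le_norm (gradient g 0) (Y ω)
  have h4 := neg_abs_le gstar
  have h5 := le_abs_self (g 0)
  have h6 := abs_nonneg (g 0)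
  have h7 := abs_nonneg gstar
  have h8 : 0 ≤ ‖gradient g 0‖ * ‖Y ω‖ := by positivity
  have h9 : 0 ≤ L / 2 * ‖Y ω‖ ^ 2 := by positivity
  rw [Real.norm_eq_abs, abs_le]
  constructor <;> linarith

namespace IsStochasticED

lemma memLp_iterate (S : IsStochasticED P W α L σ f G ξ x0) (k : ℕ) (i : Fin n) :
    MemLp (fun ω => edIterate W α G ξ x0 k ω i) 2 P := by
  refine edIterate_induction (Q := fun Y => MemLp Y 2 P) (fun c => memLp_const c)
    (fun _ _ hY hZ => hY.sub hZ) (fun c _ hY => hY.const_smul c)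
    (fun _ hY => memLp_finsetSum _ fun j _ => hY j) (fun k i hk => ?_) k i
  have h := (memLp_gradient (S.smooth i) S.lipschitz_pos.le hk).add
    (S.noise.square_integrable k i)
  exact h.ae_eq (Eventually.of_forall fun ω => (grad_eq_add_gradNoise k i ω).symm)

lemma integral_noise_sq_le (S : IsStochasticED P W α L σ f G ξ x0) (k : ℕ) (i : Fin n) :
    ∫ ω, ‖gradNoise f G ξ (edIterate W α G ξ x0) k i ω‖ ^ 2 ∂P ≤ σ ^ 2 := by
  rw [← integral_condExp (S.pastSigma_le k)]
  calc _ ≤ ∫ _, σ ^ 2 ∂P :=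
        integral_mono_ae integrable_condExp (integrable_const _) (S.noise.variance_le k i)
    _ = σ ^ 2 := by simp

lemma integral_inner_noise (S : IsStochasticED P W α L σ f G ξ x0) (k : ℕ) (i : Fin n)
    {a : Ω → Vec d} (ha : MemLp a 2 P)
    (ham : StronglyMeasurable[pastSigma (edIterate W α G ξ x0) k] a) :
    ∫ ω, inner ℝ (a ω) (gradNoise f G ξ (edIterate W α G ξ x0) k i ω) ∂P = 0 :=
  integral_inner_eq_zero (S.pastSigma_le k) ha (S.noise.square_integrable k i) ham
    (S.noise.mean_zero k i)

lemma integral_inner_mean_noise (S : IsStochasticED P W α L σ f G ξ x0) (k : ℕ)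
    {a : Ω → Vec d} (ha : MemLp a 2 P)
    (ham : StronglyMeasurable[pastSigma (edIterate W α G ξ x0) k] a) :
    ∫ ω, inner ℝ (a ω)
      (agentMean fun i => gradNoise f G ξ (edIterate W α G ξ x0) k i ω) ∂P = 0 := by
  simp only [agentMean, inner_smul_right, inner_sum]
  rw [integral_const_mul, integral_finsetSum _ fun i _ =>
    ha.integrable_inner_real (S.noise.square_integrable k i)]
  simp [S.integral_inner_noise k _ ha ham]

/-- Averaging reduces the variance of the noise by the factor `n`. -/
lemma integral_mean_noise_sq_le (S : IsStochasticED P W α L σ f G ξ x0) (k : ℕ) :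
    ∫ ω, ‖agentMean fun i => gradNoise f G ξ (edIterate W α G ξ x0) k i ω‖ ^ 2 ∂P
      ≤ σ ^ 2 / n := by
  have hn : (0 : ℝ) < n := by exact_mod_cast S.agents_pos
  set v := gradNoise f G ξ (edIterate W α G ξ x0) k with hv
  have hvL : ∀ i, MemLp (v i) 2 P := fun i => S.noise.square_integrable k i
  have e : ∀ ω, ‖agentMean fun i => v i ω‖ ^ 2
      = (1 / (n : ℝ)) ^ 2 * ∑ i, ∑ j, inner ℝ (v i ω) (v j ω) := fun ω => by
    rw [agentMean, norm_smul, mul_pow, Real.norm_eq_abs, sq_abs, ← real_inner_self_eq_norm_sq,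
      sum_inner]
    simp_rw [inner_sum]
  have hint : ∀ i j, Integrable (fun ω => inner ℝ (v i ω) (v j ω)) P := fun i j =>
    (hvL i).integrable_inner_real (hvL j)
  -- Only the `n` diagonal terms of the double sum survive; against the factor `1/n²` they give
  -- `σ²/n`.
  have hoff : ∀ i j, i ≠ j → ∫ ω, inner ℝ (v i ω) (v j ω) ∂P = 0 := fun i j hij =>
    (S.noise.cond_indep k).integral_inner_eq_zero (S.pastSigma_le k) (S.measurable_sample k) hij
      (hvL i) (hvL j) (S.stronglyMeasurable_noise k i) (S.stronglyMeasurable_noise k j)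
      (S.noise.mean_zero k j)
  simp_rw [e]
  rw [integral_const_mul, integral_finsetSum _ fun i _ => integrable_finsetSum _ fun j _ => hint i j]
  have h1 : ∀ i, ∫ ω, ∑ j, inner ℝ (v i ω) (v j ω) ∂P ≤ σ ^ 2 := fun i => by
    rw [integral_finsetSum _ fun j _ => hint i j,
      Finset.sum_eq_single i (fun j _ hj => hoff i j hj.symm) (by simp)]
    simp_rw [real_inner_self_eq_norm_sq]
    exact S.integral_noise_sq_le k i
  calc _ ≤ (1 / (n : ℝ)) ^ 2 * ∑ _i : Fin n, σ ^ 2 := by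
        gcongr with i _
        exact h1 i
    _ = σ ^ 2 / n := by simp; field_simp

end IsStochasticED

end Stochastic

/-! ### Recursions in expectation. -/

section Expectation

variable {n d : ℕ} {Ω : Type*}

lemma measurable_modal {m : MeasurableSpace Ω} (a : Fin n → ℝ) {Y : Ω → Fin n → Vec d}
    (hY : ∀ i, Measurable (fun ω => Y ω i)) : Measurable (fun ω => modal a (Y ω)) :=
  Finset.measurable_fun_sum _ fun i _ => (hY i).const_smul (a i)

lemma measurable_agentMean {m : MeasurableSpace Ω} {Y : Ω → Fin n → Vec d}
    (hY : ∀ i, Measurable (fun ω => Y ω i)) : Measurable (fun ω => agentMean (Y ω)) :=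
  (Finset.measurable_fun_sum Finset.univ fun i _ => hY i).const_smul (1 / (n : ℝ))

variable [m0 : MeasurableSpace Ω] {Ξ : Fin n → Type*}
  [∀ i, MeasurableSpace (Ξ i)] {P : Measure Ω}
  {W : Matrix (Fin n) (Fin n) ℝ} {α L σ : ℝ} {f : Fin n → Vec d → ℝ}
  {G : ∀ i, Vec d → Ξ i → Vec d} {ξ : ℕ → ∀ i, Ω → Ξ i} {x0 : Vec d}
  {l lmin : ℝ} {u : Fin n → Fin n → ℝ} {t : Fin n → ℝ}

lemma memLp_modal (a : Fin n → ℝ) {Y : Ω → Fin n → Vec d}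
    (hY : ∀ i, MemLp (fun ω => Y ω i) 2 P) : MemLp (fun ω => modal a (Y ω)) 2 P :=
  memLp_finsetSum _ fun i _ => (hY i).const_smul (a i)

/-- Expected energy at iteration `k`. -/
def expEnergy (P : Measure Ω) (f : Fin n → Vec d → ℝ) (α : ℝ) (u : Fin n → Fin n → ℝ)
    (t : Fin n → ℝ) (X : ℕ → Ω → Fin n → Vec d) (k : ℕ) : ℝ :=
  ∫ ω, energy α u t (fun k => X k ω) (fun i => gradient (f i) (agentMean (X k ω))) k ∂P

/-- Expected suboptimality of the mean iterate. -/
def expGap (P : Measure Ω) (f : Fin n → Vec d → ℝ) (fstar : ℝ) (X : ℕ → Ω → Fin n → Vec d)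
    (k : ℕ) : ℝ :=
  ∫ ω, (aggregate f (agentMean (X k ω)) - fstar) ∂P

/-- Expected squared norm of the mean gradient. -/
def expGrad (P : Measure Ω) (f : Fin n → Vec d → ℝ) (X : ℕ → Ω → Fin n → Vec d) (k : ℕ) : ℝ :=
  ∫ ω, ‖agentMean (fun i => gradient (f i) (X k ω i))‖ ^ 2 ∂P

lemma expEnergy_nonneg (hu : IsModalBasis W l lmin u t) (hl : l < 1)
    (X : ℕ → Ω → Fin n → Vec d) (k : ℕ) : 0 ≤ expEnergy P f α u t X k :=
  integral_nonneg fun _ => hu.energy_nonneg hl _ _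

lemma expGap_nonneg {fstar : ℝ} (hstar : ∀ x, fstar ≤ aggregate f x)
    (X : ℕ → Ω → Fin n → Vec d) (k : ℕ) : 0 ≤ expGap P f fstar X k :=
  integral_nonneg fun _ => sub_nonneg.2 (hstar _)

lemma expGrad_nonneg (X : ℕ → Ω → Fin n → Vec d) (k : ℕ) : 0 ≤ expGrad P f X k :=
  integral_nonneg fun _ => sq_nonneg _

namespace IsStochasticED

lemma memLp_meanNoise (S : IsStochasticED P W α L σ f G ξ x0) (k : ℕ) :
    MemLp (fun ω => agentMean
      (fun i => gradNoise f G ξ (edIterate W α G ξ x0) k i ω)) 2 P :=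
  memLp_agentMean (S.noise.square_integrable k)

variable [IsProbabilityMeasure P]

lemma memLp_mean (S : IsStochasticED P W α L σ f G ξ x0) (k : ℕ) :
    MemLp (fun ω => agentMean (edIterate W α G ξ x0 k ω)) 2 P :=
  memLp_agentMean (S.memLp_iterate k)

lemma memLp_meanGrad (S : IsStochasticED P W α L σ f G ξ x0) (k : ℕ) :
    MemLp (fun ω => agentMean (fun i => gradient (f i) (edIterate W α G ξ x0 k ω i))) 2 P :=
  memLp_agentMean fun i => memLp_gradient (S.smooth i) S.lipschitz_pos.le (S.memLp_iterate k i)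

lemma integrable_energy (S : IsStochasticED P W α L σ f G ξ x0) (k : ℕ) :
    Integrable (fun ω => energy α u t (fun k => edIterate W α G ξ x0 k ω)
      (fun i => gradient (f i) (agentMean (edIterate W α G ξ x0 k ω))) k) P := by
  refine integrable_finsetSum _ fun j _ => ?_
  have hd : MemLp (fun ω => modalDual (u j) (t j) (fun k => edIterate W α G ξ x0 k ω) k) 2 P :=
    (memLp_finsetSum (Finset.range k) fun r _ =>
      memLp_modal (u j) (S.memLp_iterate (r + 1))).const_smul (1 - t j)
  have hc : MemLp (fun ω => modal (u j)
      (fun i => gradient (f i) (agentMean (edIterate W α G ξ x0 k ω)))) 2 P :=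
    memLp_modal (u j) fun i =>
      memLp_gradient (S.smooth i) S.lipschitz_pos.le (S.memLp_mean k)
  exact (memLp_modal (u j) (S.memLp_iterate k)).norm.integrable_sq.add
    ((hd.add (hc.const_smul (α * t j))).norm.integrable_sq.div_const _)

/-- Pythagoras in `L²`: the mean of the true gradients is known from the past, and the averaged
noise is orthogonal to it. -/
lemma integral_mean_stochastic_grad_sq_le (S : IsStochasticED P W α L σ f G ξ x0) (k : ℕ) :
    ∫ ω, ‖agentMean (fun i => gradient (f i) (edIterate W α G ξ x0 k ω i))
      + agentMean (fun i => gradNoise f G ξ (edIterate W α G ξ x0) k i ω)‖ ^ 2 ∂P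
      ≤ expGrad P f (edIterate W α G ξ x0) k + σ ^ 2 / n := by
  have hm := S.memLp_meanGrad k
  have hv := S.memLp_meanNoise k
  have hmm : StronglyMeasurable[pastSigma (edIterate W α G ξ x0) k]
      (fun ω => agentMean (fun i => gradient (f i) (edIterate W α G ξ x0 k ω i))) :=
    (measurable_agentMean fun i =>
      ((S.smooth i).continuous_gradient S.lipschitz_pos.le).measurable.comp
        (measurable_pastSigma le_rfl i)).stronglyMeasurable
  have h0 := S.integral_inner_mean_noise k hm hmm
  simp_rw [norm_add_sq_real]
  have hi := (hm.integrable_inner_real hv).const_mul 2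
  refine (integral_add' (hm.norm.integrable_sq.add hi) hv.norm.integrable_sq).trans_le ?_
  rw [integral_add' hm.norm.integrable_sq hi, integral_const_mul, h0, mul_zero, add_zero]
  exact add_le_add_right (S.integral_mean_noise_sq_le k) _

lemma expEnergy_succ_le (S : IsStochasticED P W α L σ f G ξ x0)
    (hu : IsModalBasis W l lmin u t) (hl0 : 0 ≤ l) (hl : l < 1) (k : ℕ) :
    expEnergy P f α u t (edIterate W α G ξ x0) (k + 1) ≤
      (√l + 4 * α ^ 2 * L ^ 2 * l / (1 - √l)) * expEnergy P f α u t (edIterate W α G ξ x0) k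
      + 2 * α ^ 2 * l * (n * σ ^ 2)
      + 4 * α ^ 4 * L ^ 2 * l / ((1 - √l) * (1 - l)) * n
        * (expGrad P f (edIterate W α G ξ x0) k + σ ^ 2 / n) := by
  have h1l : 0 < 1 - l := sub_pos.2 hl
  have h1r : 0 < 1 - √l := by
    rw [sub_pos, Real.sqrt_lt' one_pos]; simpa using hl
  set X := edIterate W α G ξ x0 with hX
  set v := gradNoise f G ξ X k with hv
  have hvL : ∀ i, MemLp (v i) 2 P := S.noise.square_integrable k
  set b : Fin n → Ω → Vec d := fun i ω => ∑ j with t j ≠ 0, (t j * u j i) • modal (u j) (X k ω)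
    with hb
  have hbL : ∀ i, MemLp (b i) 2 P := fun i => memLp_finsetSum _ fun j _ =>
    (memLp_modal (u j) (S.memLp_iterate k)).const_smul (t j * u j i)
  have hbm : ∀ i, StronglyMeasurable[pastSigma X k] (b i) := fun i =>
    Measurable.stronglyMeasurable (Finset.measurable_fun_sum _ fun j _ =>
      (measurable_modal (u j) (measurable_pastSigma le_rfl)).const_smul (t j * u j i))
  have hi1 := S.integrable_energy (u := u) (t := t) (k + 1)
  have hi2 := (S.integrable_energy (u := u) (t := t) k).const_mul
    (√l + 4 * α ^ 2 * L ^ 2 * l / (1 - √l))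
  have hi3 : Integrable (fun ω => 2 * α * ∑ i, inner ℝ (b i ω) (v i ω)) P :=
    (integrable_finsetSum _ fun i _ => (hbL i).integrable_inner_real (hvL i)).const_mul _
  have hi4 : Integrable (fun ω => 2 * α ^ 2 * l * ∑ i, ‖v i ω‖ ^ 2) P :=
    (integrable_finsetSum _ fun i _ => (hvL i).norm.integrable_sq).const_mul _
  have hi5 := (((S.memLp_meanGrad k).add (S.memLp_meanNoise k)).norm.integrable_sq).const_mul
    (4 * α ^ 4 * L ^ 2 * l / ((1 - √l) * (1 - l)) * n)
  have key := integral_mono hi1 (((hi2.sub hi3).add hi4).add hi5) fun ω =>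
    (isEDTrajectory_edIterate (W := W) (α := α) (G := G) (ξ := ξ) (x0 := x0) ω).energy_gradient_step
      S.agents_pos S.stochastic hu hl0 hl S.smooth k (fun i => v i ω)
      fun i => grad_eq_add_gradNoise k i ω
  refine key.trans ?_
  rw [integral_add' ((hi2.sub hi3).add hi4) hi5, integral_add' (hi2.sub hi3) hi4,
    integral_sub' hi2 hi3, integral_const_mul, integral_const_mul, integral_const_mul,
    integral_const_mul, integral_finsetSum _ fun i _ => (hbL i).integrable_inner_real (hvL i),
    integral_finsetSum _ fun i _ => (hvL i).norm.integrable_sq]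
  -- The vectors `b i` are functions of the `k`-th iterate.
  have e0 : ∑ i, ∫ ω, inner ℝ (b i ω) (v i ω) ∂P = 0 :=
    Finset.sum_eq_zero fun i _ => S.integral_inner_noise k i (hbL i) (hbm i)
  have e1 : ∑ i, ∫ ω, ‖v i ω‖ ^ 2 ∂P ≤ n * σ ^ 2 := by
    refine (Finset.sum_le_sum fun i _ => S.integral_noise_sq_le k i).trans_eq ?_
    simp
  have e2 := S.integral_mean_stochastic_grad_sq_le k
  rw [e0, mul_zero, sub_zero]
  refine add_le_add (add_le_add le_rfl ?_) ?_
  · exact mul_le_mul_of_nonneg_left e1 (by positivity)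
  · exact mul_le_mul_of_nonneg_left e2 (by positivity)

lemma integrable_gap (S : IsStochasticED P W α L σ f G ξ x0) {fstar : ℝ}
    (hstar : ∀ x, fstar ≤ aggregate f x) {Y : Ω → Vec d} (hY : MemLp Y 2 P) :
    Integrable (fun ω => aggregate f (Y ω)) P :=
  (isLSmooth_aggregate S.agents_pos S.smooth).integrable_comp S.lipschitz_pos hstar hY

lemma expGap_succ_le (S : IsStochasticED P W α L σ f G ξ x0)
    (hu : IsModalBasis W l lmin u t) (hl : l < 1) (hα : 0 ≤ α) {fstar μ : ℝ}
    (hstar : ∀ x, fstar ≤ aggregate f x) (hPL : SatisfiesPL μ (aggregate f) fstar) (k : ℕ) :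
    expGap P f fstar (edIterate W α G ξ x0) (k + 1) ≤
      (1 - α * μ) * expGap P f fstar (edIterate W α G ξ x0) k
      - α / 2 * expGrad P f (edIterate W α G ξ x0) k
      + α * L ^ 2 / (2 * n) * expEnergy P f α u t (edIterate W α G ξ x0) k
      + L * α ^ 2 / 2 * (expGrad P f (edIterate W α G ξ x0) k + σ ^ 2 / n) := by
  set X := edIterate W α G ξ x0 with hX
  set v := gradNoise f G ξ X k with hv
  have hL := S.lipschitz_pos
  have hsm := isLSmooth_aggregate S.agents_pos S.smooth
  have hgL : MemLp (fun ω => gradient (aggregate f) (agentMean (X k ω))) 2 P :=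
    memLp_gradient hsm hL.le (S.memLp_mean k)
  have hgm : StronglyMeasurable[pastSigma X k]
      (fun ω => gradient (aggregate f) (agentMean (X k ω))) :=
    Measurable.stronglyMeasurable ((hsm.continuous_gradient hL.le).measurable.comp
      (measurable_agentMean fun i => measurable_pastSigma le_rfl i))
  have hi : ∀ k, Integrable (fun ω => aggregate f (agentMean (X k ω)) - fstar) P := fun k =>
    (S.integrable_gap hstar (S.memLp_mean k)).sub (integrable_const _)
  have hi1 := (hi k).const_mul (1 - α * μ)
  have hi2 := (S.memLp_meanGrad k).norm.integrable_sq.const_mul (α / 2)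
  have hi3 := (S.integrable_energy (u := u) (t := t) k).const_mul (α * L ^ 2 / (2 * n))
  have hi4 := (hgL.integrable_inner_real (S.memLp_meanNoise k)).const_mul α
  have hi5 := (((S.memLp_meanGrad k).add (S.memLp_meanNoise k)).norm.integrable_sq).const_mul
    (L * α ^ 2 / 2)
  have key := integral_mono (hi (k + 1)) ((((hi1.sub hi2).add hi3).sub hi4).add hi5) fun ω => by
    have h1 := (isEDTrajectory_edIterate (W := W) (α := α) (G := G) (ξ := ξ) (x0 := x0)
      ω).descent_step S.agents_pos hα S.stochastic hu hl S.smooth k (fun i => v i ω)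
      (fun i => gradient (f i) (agentMean (X k ω))) fun i => grad_eq_add_gradNoise k i ω
    have h2 := mul_le_mul_of_nonneg_left (hPL (agentMean (X k ω))) 
      (by positivity : 0 ≤ α / 2)
    simp only [Pi.add_apply, Pi.sub_apply]
    linarith
  refine key.trans ?_
  rw [integral_add' (((hi1.sub hi2).add hi3).sub hi4) hi5, integral_sub' ((hi1.sub hi2).add hi3) hi4,
    integral_add' (hi1.sub hi2) hi3, integral_sub' hi1 hi2, integral_const_mul,
    integral_const_mul, integral_const_mul, integral_const_mul, integral_const_mul,
    S.integral_inner_mean_noise k hgL hgm, mul_zero, sub_zero]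
  exact add_le_add_right (mul_le_mul_of_nonneg_left (S.integral_mean_stochastic_grad_sq_le k)
    (by positivity)) _

/-- The mean gradient is compared with `∇f` at the mean point, whose square is at most `2L` times
the gap. This closes the recursion of the energy in terms of gap and energy. -/
lemma expGrad_le (S : IsStochasticED P W α L σ f G ξ x0)
    (hu : IsModalBasis W l lmin u t) (hl : l < 1) {fstar : ℝ}
    (hstar : ∀ x, fstar ≤ aggregate f x) (k : ℕ) :
    expGrad P f (edIterate W α G ξ x0) k ≤
      4 * L * expGap P f fstar (edIterate W α G ξ x0) k
      + 2 * L ^ 2 * (expEnergy P f α u t (edIterate W α G ξ x0) k / n) := by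
  set X := edIterate W α G ξ x0 with hX
  have hL := S.lipschitz_pos
  have hn : (0 : ℝ) < n := by exact_mod_cast S.agents_pos
  have hsm := isLSmooth_aggregate S.agents_pos S.smooth
  have hi1 := ((S.integrable_gap hstar (S.memLp_mean k)).sub (integrable_const fstar)).const_mul
    (4 * L)
  have hi3 := ((S.integrable_energy (u := u) (t := t) k).div_const (n : ℝ)).const_mul (2 * L ^ 2)
  have key := integral_mono (S.memLp_meanGrad k).norm.integrable_sq (hi1.add hi3) fun ω => by
    have h1 := hsm.norm_gradient_sq_le hL hstar (agentMean (X k ω))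
    have h2 := (isEDTrajectory_edIterate (W := W) (α := α) (G := G) (ξ := ξ) (x0 := x0)
      ω).sum_dev_sq_le_energy S.agents_pos S.stochastic hu hl
        (fun i => gradient (f i) (agentMean (X k ω))) k
    have h3 : ‖agentMean (fun i => gradient (f i) (X k ω i))
        - gradient (aggregate f) (agentMean (X k ω))‖ ^ 2
        ≤ 1 / (n : ℝ) * (L ^ 2 * ∑ i, ‖X k ω i - agentMean (X k ω)‖ ^ 2) := by
      rw [gradient_aggregate S.smooth, agentMean, ← smul_sub, ← Finset.sum_sub_distrib]
      refine (norm_mean_sq_le _).trans ?_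
      gcongr
      exact sum_gradient_sub_sq_le S.smooth (X k ω) (fun _ => agentMean (X k ω))
    have h4 : ∀ a b : Vec d, ‖a‖ ^ 2 ≤ 2 * ‖b‖ ^ 2 + 2 * ‖a - b‖ ^ 2 := fun a b => by
      have e := parallelogram_law_with_norm ℝ b (a - b)
      rw [add_sub_cancel] at e
      nlinarith [sq_nonneg ‖b - (a - b)‖]
    have h5 := h4 (agentMean (fun i => gradient (f i) (X k ω i)))
      (gradient (aggregate f) (agentMean (X k ω)))
    have h6 : 1 / (n : ℝ) * (L ^ 2 * ∑ i, ‖X k ω i - agentMean (X k ω)‖ ^ 2)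
      ≤ 1 / (n : ℝ) * (L ^ 2 * energy α u t (fun k => X k ω)
        (fun i => gradient (f i) (agentMean (X k ω))) k) := by gcongr
    have h7 : 1 / (n : ℝ) * (L ^ 2 * energy α u t (fun k => X k ω)
        (fun i => gradient (f i) (agentMean (X k ω))) k)
      = L ^ 2 * (energy α u t (fun k => X k ω)
        (fun i => gradient (f i) (agentMean (X k ω))) k / n) := by ring
    simp only [Pi.add_apply, Pi.sub_apply]
    linarith
  refine key.trans_eq ?_
  rw [integral_add' hi1 hi3, integral_const_mul, integral_const_mul, integral_div]
  rfl

lemma meanError_le (S : IsStochasticED P W α L σ f G ξ x0)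
    (hu : IsModalBasis W l lmin u t) (hl : l < 1) {fstar : ℝ}
    (hstar : ∀ x, fstar ≤ aggregate f x) (k : ℕ) :
    meanError P f fstar (edIterate W α G ξ x0) k ≤
      expGap P f fstar (edIterate W α G ξ x0) k
      + L / 2 * (expEnergy P f α u t (edIterate W α G ξ x0) k / n) := by
  set X := edIterate W α G ξ x0 with hX
  have hL := S.lipschitz_pos
  have hn : (0 : ℝ) < n := by exact_mod_cast S.agents_pos
  have hi1 := (S.integrable_gap hstar (S.memLp_mean k)).sub (integrable_const fstar)
  have hi3 := ((S.integrable_energy (u := u) (t := t) k).div_const (n : ℝ)).const_mul (L / 2)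
  have hi : ∀ i, Integrable (fun ω => aggregate f (X k ω i) - fstar) P := fun i =>
    (S.integrable_gap hstar (S.memLp_iterate k i)).sub (integrable_const _)
  rw [meanError, ← integral_finsetSum _ fun i _ => hi i, ← integral_const_mul]
  have key := integral_mono ((integrable_finsetSum Finset.univ fun i _ => hi i).const_mul
    (1 / (n : ℝ))) (hi1.add hi3) fun ω => by
    have h1 := mean_aggregate_le S.agents_pos S.smooth (X k ω)
    have h2 := (isEDTrajectory_edIterate (W := W) (α := α) (G := G) (ξ := ξ) (x0 := x0)
      ω).sum_dev_sq_le_energy S.agents_pos S.stochastic hu hl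
        (fun i => gradient (f i) (agentMean (X k ω))) k
    have h3 : L / 2 * (1 / (n : ℝ) * ∑ i, ‖X k ω i - agentMean (X k ω)‖ ^ 2)
        ≤ L / 2 * (1 / (n : ℝ) * energy α u t (fun k => X k ω)
        (fun i => gradient (f i) (agentMean (X k ω))) k) := by gcongr
    have h4 : 1 / (n : ℝ) * ∑ i, (aggregate f (X k ω i) - fstar)
        = 1 / (n : ℝ) * ∑ i, aggregate f (X k ω i) - fstar := by
      rw [Finset.sum_sub_distrib, Finset.sum_const, Finset.card_univ, Fintype.card_fin,
        nsmul_eq_mul]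
      field_simp
    have h5 : L / 2 * (1 / (n : ℝ) * energy α u t (fun k => X k ω)
        (fun i => gradient (f i) (agentMean (X k ω))) k) = L / 2 * (energy α u t (fun k => X k ω)
        (fun i => gradient (f i) (agentMean (X k ω))) k / n) := by ring
    change 1 / (n : ℝ) * ∑ i, aggregate f (X k ω i) ≤ aggregate f (agentMean (X k ω))
      + L / 2 * (1 / (n : ℝ) * ∑ i, ‖X k ω i - agentMean (X k ω)‖ ^ 2) at h1
    simp only [Pi.add_apply, Pi.sub_apply]
    linarith
  refine key.trans_eq ?_
  rw [integral_add' hi1 hi3, integral_const_mul, integral_div]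
  rfl

lemma expGap_zero (S : IsStochasticED P W α L σ f G ξ x0) (fstar : ℝ) :
    expGap P f fstar (edIterate W α G ξ x0) 0 = aggregate f x0 - fstar := by
  have h : ∀ ω, agentMean (edIterate W α G ξ x0 0 ω) = x0 := fun ω => by
    have : edIterate W α G ξ x0 0 ω = fun _ => x0 := funext (isEDTrajectory_edIterate ω).init
    rw [this, agentMean_const S.agents_pos]
  simp [expGap, h]

lemma expEnergy_zero_le (S : IsStochasticED P W α L σ f G ξ x0)
    (hu : IsModalBasis W l lmin u t) (hl : l < 1) (hlmin : 0 < lmin) :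
    expEnergy P f α u t (edIterate W α G ξ x0) 0 / n
      ≤ α ^ 2 * zetaSq W f x0 / ((1 - l) * lmin) := by
  have hn : (0 : ℝ) < n := by exact_mod_cast S.agents_pos
  have h : ∀ ω, agentMean (edIterate W α G ξ x0 0 ω) = x0 := fun ω => by
    have : edIterate W α G ξ x0 0 ω = fun _ => x0 := funext (isEDTrajectory_edIterate ω).init
    rw [this, agentMean_const S.agents_pos]
  have key := integral_mono (S.integrable_energy (u := u) (t := t) 0)
    (integrable_const (α ^ 2 / ((1 - l) * lmin)
      * ∑ i, ‖∑ j, W i j • gradient (f j) x0 - gradient (aggregate f) x0‖ ^ 2)) fun ω => by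
    simp only [h]
    exact (isEDTrajectory_edIterate ω).energy_zero_le hu hl hlmin _ _
  simp only [integral_const, probReal_univ, one_smul] at key
  rw [div_le_iff₀ hn]
  refine key.trans_eq ?_
  rw [zetaSq]
  field_simp

end IsStochasticED

end Expectation

/-! ### Scalar recursions and step size conditions. -/

section Scalar

lemma le_geometric_add {β N : ℝ} (hβ : 0 < β) (hβ1 : β ≤ 1) {V : ℕ → ℝ}
    (hV : ∀ k, V (k + 1) ≤ (1 - β) * V k + N) (hN : 0 ≤ N) (k : ℕ) :
    V k ≤ (1 - β) ^ k * V 0 + N / β := by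
  have hb : 0 ≤ 1 - β := sub_nonneg.2 hβ1
  induction k with
  | zero => simpa using div_nonneg hN hβ.le
  | succ k ih =>
    calc V (k + 1) ≤ (1 - β) * ((1 - β) ^ k * V 0 + N / β) + N :=
          (hV k).trans (by gcongr)
      _ = _ := by rw [pow_succ]; field_simp; ring

/-- Solution of the coupled recursion for the suboptimality `F`, the energy `e` and the squared
gradient `g`. -/
lemma coupled_recursion {α β μ L l r A τ ν : ℝ} {F e g : ℕ → ℝ} (hα : 0 < α) (hμ : 0 < μ)
    (hμL : μ ≤ L) (hβ : β = α * μ / 2) (hl0 : 0 ≤ l) (hl1 : l < 1) (hr : 0 < r) (hr1 : r ≤ 1)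
    (hτ : 0 ≤ τ) (hν : 0 ≤ ν) (hA : A = 4 * α ^ 4 * L ^ 2 * l / (r * (1 - l)))
    (h1 : α * L ≤ r / 3) (h2 : α ^ 2 * L ^ 2 ≤ (1 - l) / 4) (h3 : α ^ 2 * L ^ 2 * l ≤ r ^ 2 / 48)
    (hF : ∀ k, 0 ≤ F k) (he : ∀ k, 0 ≤ e k) (hg0 : ∀ k, 0 ≤ g k)
    (hFs : ∀ k, F (k + 1) ≤ (1 - α * μ) * F k - α / 2 * g k + α * L ^ 2 / 2 * e k
      + L * α ^ 2 / 2 * (g k + τ))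
    (hes : ∀ k, e (k + 1) ≤ (1 - r + 4 * α ^ 2 * L ^ 2 * l / r) * e k + 2 * α ^ 2 * ν
      + A * (g k + τ))
    (hg : ∀ k, g k ≤ 4 * L * F k + 2 * L ^ 2 * e k) (k : ℕ) :
    F k + L / 2 * e k ≤ (1 - β) ^ k * (2 * F 0 + 8 * L * e 0)
      + 2 * (α * L / μ * τ) + 3 * (L ^ 2 / (μ * r) * (2 * α ^ 2 * ν + A * τ)) := by
  have hL : 0 < L := hμ.trans_le hμL
  have h1l : 0 < 1 - l := sub_pos.2 hl1
  have hβ0 : 0 < β := by rw [hβ]; positivity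
  have hβr : β ≤ r / 6 := by
    have : α * μ ≤ α * L := by gcongr
    rw [hβ]; linarith
  have hA0 : 0 ≤ A := by rw [hA]; positivity
  have hAL : A * L ^ 2 ≤ r / 48 := by
    have : A * L ^ 2 = 4 * (α ^ 2 * L ^ 2 * l) * (α ^ 2 * L ^ 2) / (r * (1 - l)) := by
      rw [hA]; field_simp
    rw [this, div_le_iff₀ (by positivity)]
    calc 4 * (α ^ 2 * L ^ 2 * l) * (α ^ 2 * L ^ 2) ≤ 4 * (r ^ 2 / 48) * ((1 - l) / 4) := by gcongr
      _ = _ := by ring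
  have hq : 4 * α ^ 2 * L ^ 2 * l / r ≤ r / 12 := by
    rw [div_le_iff₀ hr]; nlinarith
  -- Chosen so that the decay `κ r e = αL² e` of the weighted energy is twice the term `αL²/2 · e`
  -- that enters the recursion of `F`.
  set κ := α * L ^ 2 / r with hκ
  have hκ0 : 0 < κ := by positivity
  have hκr : κ * r = α * L ^ 2 := by rw [hκ]; field_simp
  have hκL : κ ≤ L / 3 := by
    rw [hκ, div_le_iff₀ hr]; nlinarith
  have hκA : κ * A ≤ α / 48 := by
    have e1 : κ * A = α / r * (A * L ^ 2) := by rw [hκ]; ring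
    rw [e1]
    calc α / r * (A * L ^ 2) ≤ α / r * (r / 48) := by gcongr
      _ = α / 48 := by field_simp
  set N2 := 2 * α ^ 2 * ν + A * τ with hN2
  have hN20 : 0 ≤ N2 := by positivity
  set N1 := L * α ^ 2 / 2 * τ + κ * N2 with hN1
  have hN10 : 0 ≤ N1 := by positivity
  have hβ1 : β ≤ 1 := by linarith
  -- All gradient feedback is paid by `-α/2 · g`: the energy contributes at most `α/48 · g` and
  -- smoothness at most `α/6 · g`.
  have hV : ∀ k, F k + κ * e k ≤ (1 - β) ^ k * (F 0 + κ * e 0) + N1 / β := by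
    refine le_geometric_add (V := fun k => F k + κ * e k) hβ0 hβ1 (fun k => ?_) hN10
    have a1 := hFs k
    have a2 := mul_le_mul_of_nonneg_left (hes k) hκ0.le
    have a3 : (κ * (4 * α ^ 2 * L ^ 2 * l / r)) * e k ≤ κ * (r / 12) * e k := by
      have := he k
      gcongr
    have a4 : κ * A * g k ≤ α / 48 * g k := mul_le_mul_of_nonneg_right hκA (hg0 k)
    have a5 : L * α ^ 2 / 2 * g k ≤ α / 6 * g k := by
      refine mul_le_mul_of_nonneg_right ?_ (hg0 k)
      nlinarith
    have a6 : κ * r * e k = α * L ^ 2 * e k := by rw [hκr]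
    have a7 : κ * β * e k ≤ κ * (r / 6) * e k := by
      have := he k
      gcongr
    have a8 : 0 ≤ α * μ / 2 * F k := by
      have := hF k
      positivity
    have a9 : 0 ≤ α * L ^ 2 * e k := by
      have := he k
      positivity
    have a10 : 0 ≤ α * g k := mul_nonneg hα.le (hg0 k)
    have a11 : β * F k = α * μ / 2 * F k := by rw [hβ]
    rw [hN1, hN2]
    linarith
  -- The bound `e ≤ (F + κe)/κ` would lose a factor of order `1/α`. Instead the first-pass bound on
  -- `F` is inserted into the recursion of `e`, where it is multiplied by the small `A`; `q` is the
  -- gain of this feedback.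
  set q := 6 * L * A / r with hq
  have hq0 : 0 ≤ q := by positivity
  have hqr : q * r = 6 * L * A := by rw [hq]; field_simp
  have hqL : L / 2 * q ≤ 1 / 16 := by
    have : L / 2 * q = 3 / r * (A * L ^ 2) := by rw [hq]; ring
    rw [this]
    calc 3 / r * (A * L ^ 2) ≤ 3 / r * (r / 48) := by gcongr
      _ = 1 / 16 := by field_simp; norm_num
  set V0 := F 0 + κ * e 0 with hV0
  have hV00 : 0 ≤ V0 := by
    have := hF 0
    have := he 0
    positivity
  have hb : 0 ≤ 1 - β := sub_nonneg.2 hβ1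
  set N3 := q * (N1 / β) + 3 / 2 * (N2 / r) with hN3
  have hN30 : 0 ≤ N3 := by positivity
  have hE : ∀ k, e k ≤ (1 - β) ^ k * (e 0 + q * V0) + N3 := by
    intro k
    induction k with
    | zero =>
      have : 0 ≤ q * V0 := by positivity
      simp only [pow_zero, one_mul]
      linarith
    | succ k ih =>
      have b1 := hes k
      have b2 := mul_le_mul_of_nonneg_left (hg k) hA0
      have b3 : 4 * α ^ 2 * L ^ 2 * l / r * e k ≤ r / 12 * e k :=
        mul_le_mul_of_nonneg_right (by assumption) (he k)
      have b4 : A * L ^ 2 * e k ≤ r / 48 * e k := mul_le_mul_of_nonneg_right hAL (he k)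
      have b5 : F k ≤ (1 - β) ^ k * V0 + N1 / β := by
        have := hV k
        have : 0 ≤ κ * e k := mul_nonneg hκ0.le (he k)
        linarith
      have b6 := mul_le_mul_of_nonneg_left b5 (by positivity : 0 ≤ 4 * L * A)
      -- The rate is `1 - r` plus `r/12` from the gradient error plus `r/24` from the energy part of
      -- `g`. The margin over `β ≤ r/6` is enough for the factor `6` in `q` to cover the `4 L A F`
      -- feedback.
      have b7 : (1 - 7 * r / 8) * e k
          ≤ (1 - 7 * r / 8) * ((1 - β) ^ k * (e 0 + q * V0) + N3) :=
        mul_le_mul_of_nonneg_left ih (by linarith)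
      set B := (1 - β) ^ k with hB
      have hB0 : 0 ≤ B := pow_nonneg hb k
      have b8 : 0 ≤ r * (B * e 0) := by
        have := he 0
        positivity
      have b9 : 0 ≤ r * (B * (q * V0)) := by positivity
      have b10 : 0 ≤ r * N3 := by positivity
      have b11 : β * (B * (e 0 + q * V0)) ≤ r / 6 * (B * (e 0 + q * V0)) := by
        have := he 0
        gcongr
      have b12 : r * (B * (q * V0)) = 6 * L * A * (B * V0) := by rw [← hqr]; ring
      have b13 : r * N3 = 6 * L * A * (N1 / β) + 3 / 2 * N2 := by
        rw [hN3, ← hqr]; field_simp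
      rw [pow_succ, ← hB]
      linarith
  have f1 := hV k
  have f2 := hE k
  set B := (1 - β) ^ k with hB
  have hB0 : 0 ≤ B := pow_nonneg hb k
  have he0 := he 0
  have hF0 := hF 0
  have f3 : F k ≤ B * V0 + N1 / β := by
    have : 0 ≤ κ * e k := mul_nonneg hκ0.le (he k)
    linarith
  have f4 := mul_le_mul_of_nonneg_left f2 (by positivity : 0 ≤ L / 2)
  have f5 : L / 2 * q * (B * V0) ≤ 1 / 16 * (B * V0) :=
    mul_le_mul_of_nonneg_right hqL (by positivity)
  have f6 : L / 2 * q * (N1 / β) ≤ 1 / 16 * (N1 / β) :=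
    mul_le_mul_of_nonneg_right hqL (by positivity)
  have f7 : B * (κ * e 0) ≤ B * (L / 3 * e 0) := by gcongr
  have f8 : N1 / β = α * L / μ * τ + 2 * (L ^ 2 / (μ * r) * N2) := by
    rw [hN1, hβ, hκ]; field_simp
  -- This is where `μ ≤ L` merges the direct noise of the energy with the noise passed on through
  -- the gap.
  have f9 : L * (N2 / r) ≤ L ^ 2 / (μ * r) * N2 := by
    have : L ^ 2 / (μ * r) * N2 - L * (N2 / r) = L * (L - μ) / (μ * r) * N2 := by
      field_simp
    have h0 : 0 ≤ L * (L - μ) / (μ * r) * N2 := by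
      have := sub_nonneg.2 hμL
      positivity
    linarith
  have f10 : 0 ≤ α * L / μ * τ := by positivity
  have f11 : 0 ≤ L ^ 2 / (μ * r) * N2 := by positivity
  have f12 : 0 ≤ B * F 0 := by positivity
  have f13 : 0 ≤ B * (L * e 0) := by positivity
  have f14 : B * V0 = B * F 0 + B * (κ * e 0) := by rw [hV0]; ring
  have f15 : L / 2 * N3 = L / 2 * q * (N1 / β) + 3 / 4 * (L * (N2 / r)) := by rw [hN3]; ring
  linarith

variable {L μ l lmin α : ℝ}

lemma one_sub_le_two_mul_one_sub_sqrt (hl0 : 0 ≤ l) : 1 - l ≤ 2 * (1 - √l) := by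
  nlinarith [Real.sq_sqrt hl0, sq_nonneg (1 - √l)]

lemma StepSizeOK.mul_le (h : StepSizeOK L μ l lmin α) (hL : 0 < L) : α * L ≤ (1 - √l) / 3 := by
  have := (le_div_iff₀ (by positivity)).1 h.1
  linarith

lemma StepSizeOK.sq_le (h : StepSizeOK L μ l lmin α) (hL : 0 < L) (hα : 0 < α) (hl : l < 1) :
    α ^ 2 * L ^ 2 ≤ (1 - l) / 4 := by
  have h1 := (le_div_iff₀ (by positivity)).1 h.2.1
  have h2 := pow_le_pow_left₀ (by positivity) h1 2
  rw [Real.sq_sqrt (sub_nonneg.2 hl.le)] at h2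
  linarith

/-- The third condition squared carries one factor `l` too many, which is cancelled using `lmin² ≤
l`. For `l = 0` the left side vanishes. -/
lemma StepSizeOK.sq_mul_le (h : StepSizeOK L μ l lmin α) (hL : 0 < L) (hα : 0 < α) (hl0 : 0 ≤ l)
    (hmin : 0 < lmin) (hmin1 : lmin ≤ 1) (hminl : l ≠ 0 → lmin ≤ l) :
    α ^ 2 * L ^ 2 * l ≤ (1 - √l) ^ 2 / 48 := by
  rcases eq_or_ne l 0 with rfl | hl
  · rw [mul_zero]; positivity
  have hl' : 0 < l := lt_of_le_of_ne hl0 hl.symm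
  have h2 := pow_le_pow_left₀ (by positivity) h.2.2.1 2
  have e : (α * (2 * √12 * L * l)) ^ 2 = 48 * (α ^ 2 * L ^ 2 * l) * l := by
    have : √12 ^ 2 = (12 : ℝ) := Real.sq_sqrt (by norm_num)
    calc (α * (2 * √12 * L * l)) ^ 2 = 4 * √12 ^ 2 * (α ^ 2 * L ^ 2 * l) * l := by ring
      _ = _ := by rw [this]; ring
  have h3 : ((1 - √l) * lmin) ^ 2 ≤ (1 - √l) ^ 2 * l := by
    rw [mul_pow]
    have : lmin ^ 2 ≤ l := by nlinarith [hminl hl]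
    gcongr
  rw [e] at h2
  have h4 := le_of_mul_le_mul_right (h2.trans h3) hl'
  linarith

/-- The noise terms of the coupled recursion in the form of the final bound. -/
lemma noise_terms_le {τ σ : ℝ} (hα : 0 < α) (hμ : 0 < μ) (hL : 0 < L) (hl0 : 0 ≤ l)
    (hl1 : l < 1) (hmin : 0 < lmin) (hminl : l ≠ 0 → lmin ≤ l) (hτ : 0 ≤ τ) :
    2 * (α * L / μ * τ) + 3 * (L ^ 2 / (μ * (1 - √l)) * (2 * α ^ 2 * (l * σ ^ 2)
        + 4 * α ^ 4 * L ^ 2 * l / ((1 - √l) * (1 - l)) * τ))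
      ≤ 48 * (α * L / μ * τ + α ^ 2 * L ^ 2 * l ^ 2 * σ ^ 2 / (μ * (1 - l) * lmin)
        + α ^ 4 * L ^ 4 * l ^ 2 / (μ * (1 - l) ^ 3 * lmin) * τ) := by
  have h1l : 0 < 1 - l := sub_pos.2 hl1
  have hr : (1 - l) / 2 ≤ 1 - √l := by linarith [one_sub_le_two_mul_one_sub_sqrt hl0]
  have hr0 : 0 < 1 - √l := lt_of_lt_of_le (by positivity) hr
  -- The recursion produces a single factor `l`; the form `l²/lmin` of the final bound is weaker,
  -- because `lmin ≤ l` unless `l = 0`.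
  have hll : l ≤ l ^ 2 / lmin := by
    rw [le_div_iff₀ hmin]
    rcases eq_or_ne l 0 with rfl | hl
    · simp
    · rw [sq]; exact mul_le_mul_of_nonneg_left (hminl hl) hl0
  set r := 1 - √l
  have t1 : L ^ 2 / (μ * r) * (2 * α ^ 2 * (l * σ ^ 2))
      ≤ 4 * (α ^ 2 * L ^ 2 * l ^ 2 * σ ^ 2 / (μ * (1 - l) * lmin)) := by
    calc L ^ 2 / (μ * r) * (2 * α ^ 2 * (l * σ ^ 2))
        ≤ L ^ 2 / (μ * ((1 - l) / 2)) * (2 * α ^ 2 * (l ^ 2 / lmin * σ ^ 2)) := by gcongr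
      _ = _ := by field_simp; ring
  have t2 : L ^ 2 / (μ * r) * (4 * α ^ 4 * L ^ 2 * l / (r * (1 - l)) * τ)
      ≤ 16 * (α ^ 4 * L ^ 4 * l ^ 2 / (μ * (1 - l) ^ 3 * lmin) * τ) := by
    calc L ^ 2 / (μ * r) * (4 * α ^ 4 * L ^ 2 * l / (r * (1 - l)) * τ)
        ≤ L ^ 2 / (μ * ((1 - l) / 2))
          * (4 * α ^ 4 * L ^ 2 * (l ^ 2 / lmin) / ((1 - l) / 2 * (1 - l)) * τ) := by gcongr
      _ = _ := by field_simp; ring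
  have t3 : 0 ≤ α * L / μ * τ := by positivity
  have t4 : 0 ≤ α ^ 2 * L ^ 2 * l ^ 2 * σ ^ 2 / (μ * (1 - l) * lmin) := by positivity
  rw [mul_add (L ^ 2 / (μ * r))]
  linarith

end Scalar

/-! ### The error bound for a fixed step size. -/

section MainBound

variable {n d : ℕ} {Ω : Type*} [m0 : MeasurableSpace Ω] {Ξ : Fin n → Type*}
  [∀ i, MeasurableSpace (Ξ i)] {P : Measure Ω} [IsProbabilityMeasure P]
  {W : Matrix (Fin n) (Fin n) ℝ} {α L μ σ : ℝ} {f : Fin n → Vec d → ℝ}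
  {G : ∀ i, Vec d → Ξ i → Vec d} {ξ : ℕ → ∀ i, Ω → Ξ i} {x0 : Vec d}

/-- Linear convergence of stochastic ED/D² to a neighbourhood of the optimal value. -/
lemma IsStochasticED.meanError_bound (S : IsStochasticED P W α L σ f G ξ x0)
    (hW : IsCombinationMatrix W) (hpsd : W.PosSemidef) (hμ : 0 < μ) (hμL : μ ≤ L) (hα : 0 < α)
    {fstar : ℝ} (hstar : ∀ x, fstar ≤ aggregate f x) (hPL : SatisfiesPL μ (aggregate f) fstar)
    (hstep : StepSizeOK L μ (mixingRate W) (minNonzeroEigenvalue W) α) (k : ℕ) :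
    meanError P f fstar (edIterate W α G ξ x0) k ≤
      (1 - α * μ / 2) ^ k * (2 * (aggregate f x0 - fstar)
        + 8 * α ^ 2 * L * zetaSq W f x0 / ((1 - mixingRate W) * minNonzeroEigenvalue W))
      + 48 * (α * L * σ ^ 2 / (μ * n)
        + α ^ 2 * L ^ 2 * mixingRate W ^ 2 * σ ^ 2
          / (μ * (1 - mixingRate W) * minNonzeroEigenvalue W)
        + α ^ 4 * L ^ 4 * mixingRate W ^ 2 * σ ^ 2
          / (μ * (1 - mixingRate W) ^ 3 * minNonzeroEigenvalue W * n)) := by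
  obtain ⟨hl0, hl1, hmin, hmin1, hminl, u, t, hu⟩ := exists_isModalBasis S.agents_pos hW hpsd
  set l := mixingRate W
  set lmin := minNonzeroEigenvalue W
  have hL := S.lipschitz_pos
  have hn : (0 : ℝ) < n := by exact_mod_cast S.agents_pos
  have h1l : 0 < 1 - l := sub_pos.2 hl1
  have hr0 : 0 < 1 - √l := by
    rw [sub_pos, Real.sqrt_lt' one_pos]; simpa using hl1
  have hb0 : 0 ≤ 1 - α * μ / 2 := by
    have h1 := hstep.mul_le hL
    have h2 : α * μ ≤ α * L := by gcongr
    linarith [Real.sqrt_nonneg l]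
  -- With `r = 1 - √l`, the energy contraction `√l` is `1 - r`. The energy is normalized per agent,
  -- so its own noise is `l σ²` while the averaged noise is `σ²/n`.
  have key := coupled_recursion (F := expGap P f fstar (edIterate W α G ξ x0))
    (e := fun k => expEnergy P f α u t (edIterate W α G ξ x0) k / n)
    (g := expGrad P f (edIterate W α G ξ x0)) (τ := σ ^ 2 / n) (ν := l * σ ^ 2)
    hα hμ hμL rfl hl0 hl1 hr0 (by linarith [Real.sqrt_nonneg l]) (by positivity) (by positivity) rfl
    (hstep.mul_le hL) (hstep.sq_le hL hα hl1) (hstep.sq_mul_le hL hα hl0 hmin hmin1 hminl)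
    (expGap_nonneg hstar _) (fun k => div_nonneg (expEnergy_nonneg hu hl1 _ k) hn.le)
    (expGrad_nonneg _)
    (fun k => (S.expGap_succ_le hu hl1 hα.le hstar hPL k).trans_eq (by ring))
    (fun k => by
      have h := S.expEnergy_succ_le hu hl0 hl1 k
      rw [div_le_iff₀ hn]
      refine h.trans_eq ?_
      rw [sub_sub_cancel]
      field_simp)
    (S.expGrad_le hu hl1 hstar) k
  refine (S.meanError_le hu hl1 hstar k).trans (key.trans ?_)
  have hnoise := noise_terms_le (τ := σ ^ 2 / n) (σ := σ) hα hμ hL hl0 hl1 hmin hminl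
    (by positivity)
  rw [add_assoc]
  refine add_le_add (mul_le_mul_of_nonneg_left ?_ (pow_nonneg hb0 k)) (hnoise.trans_eq ?_)
  · rw [S.expGap_zero]
    have h0 := mul_le_mul_of_nonneg_left (S.expEnergy_zero_le hu hl1 hmin)
      (by positivity : 0 ≤ 8 * L)
    have e : 8 * L * (α ^ 2 * zetaSq W f x0 / ((1 - l) * lmin))
      = 8 * α ^ 2 * L * zetaSq W f x0 / ((1 - l) * lmin) := by ring
    linarith
  · field_simp

end MainBound

/-! ### The step size adapted to a horizon of `K` steps. -/

section Horizon

variable {L μ l lmin : ℝ} {K : ℕ}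

lemma horizonStep_eq (μ : ℝ) (K : ℕ) : horizonStep μ K = 4 * Real.log K / (μ * K) := by
  rw [horizonStep, Real.log_pow]; push_cast; ring

lemma half_le_log (hK : 2 ≤ K) : 1 / 2 ≤ Real.log K := by
  have h1 : Real.log 2 ≤ Real.log K :=
    Real.log_le_log (by norm_num) (by exact_mod_cast hK)
  linarith [Real.log_two_gt_d9]

lemma horizonStep_pos (hμ : 0 < μ) (hK : 2 ≤ K) : 0 < horizonStep μ K := by
  have h1 := half_le_log hK
  have h2 : (0 : ℝ) < K := by positivity
  rw [horizonStep_eq]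
  have : 0 < Real.log K := by linarith
  positivity

lemma one_sub_horizonStep_pow_le (hμ : 0 < μ) (hK : 2 ≤ K)
    (h0 : 0 ≤ 1 - horizonStep μ K * μ / 2) :
    (1 - horizonStep μ K * μ / 2) ^ K ≤ 1 / (K : ℝ) ^ 2 := by
  have hK0 : (0 : ℝ) < K := by positivity
  calc (1 - horizonStep μ K * μ / 2) ^ K ≤ (Real.exp (-(horizonStep μ K * μ / 2))) ^ K :=
        pow_le_pow_left₀ h0 (Real.one_sub_le_exp_neg _) K
    _ = Real.exp (-(2 * Real.log K)) := by
        rw [← Real.exp_nat_mul, horizonStep_eq]; congr 1; field_simp; ring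
    _ = 1 / (K : ℝ) ^ 2 := by
        rw [Real.exp_neg, two_mul, Real.exp_add, Real.exp_log hK0]; field_simp

/-- The constant of the bound after `K` steps. -/
def horizonConst (L μ : ℝ) : ℝ :=
  512 * L / μ ^ 2 + 1536 * L / μ ^ 2 + 3072 * L ^ 2 / μ ^ 3 + 12288 * L ^ 4 / μ ^ 5

/-- A constant that makes the horizon step size admissible. -/
def admissibleConst (L μ : ℝ) : ℝ := 64 * L / μ + 2304 * L ^ 4 / μ ^ 4 + 1

lemma horizon_bound_le {gap z σ : ℝ} {n : ℕ} (hL : 0 < L) (hμ : 0 < μ)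
    (hK : 2 ≤ K) (hn : 0 < n) (hl1 : l < 1) (hmin : 0 < lmin)
    (hgap : 0 ≤ gap) (hz : 0 ≤ z) (h0 : 0 ≤ 1 - horizonStep μ K * μ / 2) :
    (1 - horizonStep μ K * μ / 2) ^ K * (2 * gap
        + 8 * horizonStep μ K ^ 2 * L * z / ((1 - l) * lmin))
      + 48 * (horizonStep μ K * L * σ ^ 2 / (μ * n)
        + horizonStep μ K ^ 2 * L ^ 2 * l ^ 2 * σ ^ 2 / (μ * (1 - l) * lmin)
        + horizonStep μ K ^ 4 * L ^ 4 * l ^ 2 * σ ^ 2 / (μ * (1 - l) ^ 3 * lmin * n))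
    ≤ 2 * gap / (K : ℝ) ^ 2 + horizonConst L μ * Real.log K ^ 4 * (σ ^ 2 / (K * n)
        + l ^ 2 * σ ^ 2 / ((K : ℝ) ^ 2 * (1 - l) * lmin)
        + z / ((K : ℝ) ^ 4 * (1 - l) * lmin)
        + l ^ 2 * σ ^ 2 / ((K : ℝ) ^ 4 * (1 - l) ^ 3 * lmin * n)) := by
  have hK0 : (0 : ℝ) < K := by positivity
  have hn0 : (0 : ℝ) < n := by exact_mod_cast hn
  have h1l : 0 < 1 - l := sub_pos.2 hl1
  have hlog := half_le_log hK
  have hpow := one_sub_horizonStep_pow_le hμ hK h0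
  have hα := horizonStep_pos hμ hK
  have hpos : 0 ≤ 2 * gap + 8 * horizonStep μ K ^ 2 * L * z / ((1 - l) * lmin) := by positivity
  have s1 := mul_le_mul_of_nonneg_right hpow hpos
  refine (add_le_add_left s1 _).trans ?_
  rw [horizonStep_eq]
  set x := Real.log K
  have hx0 : 0 < x := by linarith
  -- As `ln K ≥ 1/2`, lower powers of the logarithm are absorbed into the fourth, the highest one,
  -- coming from `α⁴`.
  have hx1 : x ≤ 8 * x ^ 4 := by
    have h : (1 / 2) ^ 3 ≤ x ^ 3 := pow_le_pow_left₀ (by norm_num) hlog 3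
    nlinarith
  have hx2 : x ^ 2 ≤ 4 * x ^ 4 := by
    have h : (1 / 2) ^ 2 ≤ x ^ 2 := pow_le_pow_left₀ (by norm_num) hlog 2
    nlinarith [sq_nonneg x]
  have i1 : 1 / (K : ℝ) ^ 2 * (8 * (4 * x / (μ * K)) ^ 2 * L * z / ((1 - l) * lmin))
      ≤ 512 * L / μ ^ 2 * x ^ 4 * (z / ((K : ℝ) ^ 4 * (1 - l) * lmin)) := by
    calc _ = 128 * L / μ ^ 2 * x ^ 2 * (z / ((K : ℝ) ^ 4 * (1 - l) * lmin)) := by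
          field_simp; ring
      _ ≤ 128 * L / μ ^ 2 * (4 * x ^ 4) * (z / ((K : ℝ) ^ 4 * (1 - l) * lmin)) := by gcongr
      _ = _ := by ring
  have i2 : 48 * (4 * x / (μ * K) * L * σ ^ 2 / (μ * n))
      ≤ 1536 * L / μ ^ 2 * x ^ 4 * (σ ^ 2 / (K * n)) := by
    calc _ = 192 * L / μ ^ 2 * x * (σ ^ 2 / (K * n)) := by field_simp; ring
      _ ≤ 192 * L / μ ^ 2 * (8 * x ^ 4) * (σ ^ 2 / (K * n)) := by gcongr
      _ = _ := by ring
  have i3 : 48 * ((4 * x / (μ * K)) ^ 2 * L ^ 2 * l ^ 2 * σ ^ 2 / (μ * (1 - l) * lmin))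
      ≤ 3072 * L ^ 2 / μ ^ 3 * x ^ 4 * (l ^ 2 * σ ^ 2 / ((K : ℝ) ^ 2 * (1 - l) * lmin)) := by
    calc _ = 768 * L ^ 2 / μ ^ 3 * x ^ 2
            * (l ^ 2 * σ ^ 2 / ((K : ℝ) ^ 2 * (1 - l) * lmin)) := by field_simp; ring
      _ ≤ 768 * L ^ 2 / μ ^ 3 * (4 * x ^ 4)
            * (l ^ 2 * σ ^ 2 / ((K : ℝ) ^ 2 * (1 - l) * lmin)) := by gcongr
      _ = _ := by ring
  have i4 : 48 * ((4 * x / (μ * K)) ^ 4 * L ^ 4 * l ^ 2 * σ ^ 2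
        / (μ * (1 - l) ^ 3 * lmin * n))
      = 12288 * L ^ 4 / μ ^ 5 * x ^ 4
        * (l ^ 2 * σ ^ 2 / ((K : ℝ) ^ 4 * (1 - l) ^ 3 * lmin * n)) := by
    field_simp; ring
  have p1 : 0 ≤ σ ^ 2 / (K * n) := by positivity
  have p2 : 0 ≤ l ^ 2 * σ ^ 2 / ((K : ℝ) ^ 2 * (1 - l) * lmin) := by positivity
  have p3 : 0 ≤ z / ((K : ℝ) ^ 4 * (1 - l) * lmin) := by positivity
  have p4 : 0 ≤ l ^ 2 * σ ^ 2 / ((K : ℝ) ^ 4 * (1 - l) ^ 3 * lmin * n) := by positivity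
  set T1 := σ ^ 2 / (K * n)
  set T2 := l ^ 2 * σ ^ 2 / ((K : ℝ) ^ 2 * (1 - l) * lmin)
  set T3 := z / ((K : ℝ) ^ 4 * (1 - l) * lmin)
  set T4 := l ^ 2 * σ ^ 2 / ((K : ℝ) ^ 4 * (1 - l) ^ 3 * lmin * n)
  have hc : ∀ c T, c ≤ horizonConst L μ → 0 ≤ T → c * x ^ 4 * T ≤ horizonConst L μ * x ^ 4 * T :=
    fun c T hc hT => by gcongr
  have c1 : 0 ≤ 512 * L / μ ^ 2 := by positivity
  have c2 : 0 ≤ 1536 * L / μ ^ 2 := by positivity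
  have c3 : 0 ≤ 3072 * L ^ 2 / μ ^ 3 := by positivity
  have c4 : 0 ≤ 12288 * L ^ 4 / μ ^ 5 := by positivity
  have j1 := hc (512 * L / μ ^ 2) T3 (by rw [horizonConst]; linarith) p3
  have j2 := hc (1536 * L / μ ^ 2) T1 (by rw [horizonConst]; linarith) p1
  have j3 := hc (3072 * L ^ 2 / μ ^ 3) T2 (by rw [horizonConst]; linarith) p2
  have j4 := hc (12288 * L ^ 4 / μ ^ 5) T4 (by rw [horizonConst]; linarith) p4
  have e : 1 / (K : ℝ) ^ 2 * (2 * gap) = 2 * gap / (K : ℝ) ^ 2 := by ring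
  rw [mul_add (1 / (K : ℝ) ^ 2), e]
  linarith

/-- After the transient time all the error terms are dominated by the linear speedup term. -/
lemma transient_bound_le {gap z σ C : ℝ} {n : ℕ} (hK : 2 ≤ K) (hn : 0 < n)
    (hl0 : 0 ≤ l) (hl1 : l < 1) (hmin : 0 < lmin) (hmin1 : lmin ≤ 1) (hgap : 0 ≤ gap)
    (hz : 0 ≤ z) (hC : 0 ≤ C) (hKn : n / ((1 - l) * lmin) ≤ (K : ℝ)) :
    2 * gap / (K : ℝ) ^ 2 + C * Real.log K ^ 4 * (σ ^ 2 / (K * n)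
        + l ^ 2 * σ ^ 2 / ((K : ℝ) ^ 2 * (1 - l) * lmin)
        + z / ((K : ℝ) ^ 4 * (1 - l) * lmin)
        + l ^ 2 * σ ^ 2 / ((K : ℝ) ^ 4 * (1 - l) ^ 3 * lmin * n))
      ≤ (3 * C + 32) * Real.log K ^ 4 * ((gap + σ ^ 2 + z) / (n * K)) := by
  have hK1 : (1 : ℝ) ≤ K := by exact_mod_cast (by omega : 1 ≤ K)
  have hK0 : (0 : ℝ) < K := by linarith
  have hn1 : (1 : ℝ) ≤ n := by exact_mod_cast hn
  have hn0 : (0 : ℝ) < n := by linarith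
  have h1l : 0 < 1 - l := sub_pos.2 hl1
  have hlog := half_le_log hK
  set x := Real.log K
  have hx : 1 ≤ 16 * x ^ 4 := by
    have h : (1 / 2) ^ 4 ≤ x ^ 4 := pow_le_pow_left₀ (by norm_num) hlog 4
    linarith
  set w := (1 - l) * lmin with hw
  have hw0 : 0 < w := mul_pos h1l hmin
  have hnw : (n : ℝ) ≤ K * w := (div_le_iff₀ hw0).1 hKn
  have hwl : w ≤ 1 - l := mul_le_of_le_one_right h1l.le hmin1
  have hw1 : w ≤ 1 := by linarith
  have hnK : (n : ℝ) ≤ K := hnw.trans (mul_le_of_le_one_right hK0.le hw1)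
  have hl2 : l ^ 2 ≤ 1 := pow_le_one₀ hl0 hl1.le
  have t0 : 2 * gap / (K : ℝ) ^ 2 ≤ 32 * x ^ 4 * (gap / (n * K)) := by
    calc 2 * gap / (K : ℝ) ^ 2 ≤ 2 * gap / (n * K) := by
          rw [sq]; gcongr
      _ = 2 * 1 * (gap / (n * K)) := by ring
      _ ≤ 2 * (16 * x ^ 4) * (gap / (n * K)) := by gcongr
      _ = _ := by ring
  have t2 : l ^ 2 * σ ^ 2 / ((K : ℝ) ^ 2 * (1 - l) * lmin) ≤ σ ^ 2 / (n * K) := by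
    have e : (K : ℝ) ^ 2 * (1 - l) * lmin = K * w * K := by rw [hw]; ring
    rw [e]
    calc l ^ 2 * σ ^ 2 / (K * w * K) ≤ 1 * σ ^ 2 / (n * K) := by gcongr
      _ = _ := by ring
  have t3 : z / ((K : ℝ) ^ 4 * (1 - l) * lmin) ≤ z / (n * K) := by
    have e : (K : ℝ) ^ 4 * (1 - l) * lmin = K ^ 2 * (K * w * K) := by rw [hw]; ring
    have e2 : (n : ℝ) * K ≤ K ^ 2 * (K * w * K) := by
      calc (n : ℝ) * K = 1 * (n * K) := by ring
        _ ≤ (K : ℝ) ^ 2 * (K * w * K) := by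
          gcongr
          exact one_le_pow₀ hK1
    rw [e]
    gcongr
  have t4 : l ^ 2 * σ ^ 2 / ((K : ℝ) ^ 4 * (1 - l) ^ 3 * lmin * n) ≤ σ ^ 2 / (n * K) := by
    have e2 : (n : ℝ) * K ≤ (K : ℝ) ^ 4 * (1 - l) ^ 3 * lmin * n := by
      -- The spare powers of `K` pay for `(1 - l)⁻³`: both `K (1 - l)` and `K w` are at least `n ≥
      -- 1`.
      have h1 : 1 ≤ K * (1 - l) := by
        calc (1 : ℝ) ≤ n := hn1
          _ ≤ K * w := hnw
          _ ≤ K * (1 - l) := by gcongr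
      have h2 : (1 : ℝ) ≤ K * w := hn1.trans hnw
      have h3 : 1 ≤ (K * (1 - l)) ^ 2 := one_le_pow₀ h1
      calc (n : ℝ) * K = 1 * 1 * (n * K) := by ring
        _ ≤ (K * (1 - l)) ^ 2 * (K * w) * (n * K) := by gcongr
        _ = _ := by rw [hw]; ring
    calc l ^ 2 * σ ^ 2 / ((K : ℝ) ^ 4 * (1 - l) ^ 3 * lmin * n)
        ≤ 1 * σ ^ 2 / (n * K) := by gcongr
      _ = _ := by ring
  have t1 : σ ^ 2 / (K * n) = σ ^ 2 / (n * K) := by rw [mul_comm]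
  have hx4 : 0 ≤ x ^ 4 := by positivity
  calc _ ≤ 32 * x ^ 4 * (gap / (n * K)) + C * x ^ 4 * (σ ^ 2 / (n * K) + σ ^ 2 / (n * K)
        + z / (n * K) + σ ^ 2 / (n * K)) := by
        rw [t1]; gcongr
    _ ≤ _ := by
        have p0 : 0 ≤ x ^ 4 * (gap / (n * K)) := by positivity
        have p1 : 0 ≤ x ^ 4 * (σ ^ 2 / (n * K)) := by positivity
        have p2 : 0 ≤ x ^ 4 * (z / (n * K)) := by positivity
        have e : (3 * C + 32) * x ^ 4 * ((gap + σ ^ 2 + z) / (n * K))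
            = (3 * C + 32) * (x ^ 4 * (gap / (n * K))) + (3 * C + 32) * (x ^ 4 * (σ ^ 2 / (n * K)))
              + (3 * C + 32) * (x ^ 4 * (z / (n * K))) := by ring
        rw [e]
        have q0 := mul_nonneg hC p0
        have q2 := mul_nonneg hC p2
        linarith

lemma stepSizeOK_horizonStep (hL : 0 < L) (hμ : 0 < μ) (hl0 : 0 ≤ l) (hl1 : l < 1)
    (hmin : 0 < lmin) (hmin1 : lmin ≤ 1) (hK : 2 ≤ K) {C : ℝ} (hC : admissibleConst L μ ≤ C)
    (hCK : C * Real.log K / ((1 - l) * lmin) ≤ (K : ℝ)) :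
    StepSizeOK L μ l lmin (horizonStep μ K) := by
  have h1l : 0 < 1 - l := sub_pos.2 hl1
  have hr := one_sub_le_two_mul_one_sub_sqrt hl0
  have hK0 : (0 : ℝ) < K := by positivity
  have hα := horizonStep_pos hμ hK
  set w := (1 - l) * lmin with hw
  have hw0 : 0 < w := mul_pos h1l hmin
  have hwl : w ≤ 1 - l := mul_le_of_le_one_right h1l.le hmin1
  have hw1 : w ≤ 1 := by linarith
  have c1 : 0 ≤ 64 * L / μ := by positivity
  have c2 : 0 ≤ 2304 * L ^ 4 / μ ^ 4 := by positivity
  have hC1 : 64 * L / μ ≤ C := by rw [admissibleConst] at hC; linarith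
  have hC2 : 2304 * L ^ 4 / μ ^ 4 ≤ C := by rw [admissibleConst] at hC; linarith
  have hC3 : 1 ≤ C := by rw [admissibleConst] at hC; linarith
  have hC0 : 0 < C := by linarith
  -- The step is at most `4w/(μC)`, so every admissibility condition reduces to a lower bound on
  -- `C`: `64L/μ` gives `αL ≤ w/16`.
  have hαw : horizonStep μ K * (μ * C) ≤ 4 * w := by
    rw [div_le_iff₀ hw0] at hCK
    rw [horizonStep_eq, div_mul_eq_mul_div, div_le_iff₀ (by positivity)]
    nlinarith
  set a := horizonStep μ K
  have hLa : a * L ≤ w / 16 := by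
    rw [div_le_iff₀ hμ] at hC1
    have : a * (64 * L) ≤ a * (μ * C) := by
      rw [mul_comm μ C]; gcongr
    linarith
  refine ⟨?_, ?_, ?_, ?_⟩
  · rw [le_div_iff₀ (by positivity)]
    linarith
  · rw [le_div_iff₀ (by positivity)]
    have : 1 - l ≤ √(1 - l) := Real.le_sqrt_of_sq_le (by nlinarith)
    linarith
  · have h12 : √12 ≤ (4 : ℝ) := by
      rw [Real.sqrt_le_left (by norm_num)]; norm_num
    calc a * (2 * √12 * L * l) ≤ a * (2 * 4 * L * 1) := by gcongr
      _ = 8 * (a * L) := by ring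
      _ ≤ w / 2 := by linarith
      _ = (1 - l) / 2 * lmin := by rw [hw]; ring
      _ ≤ (1 - √l) * lmin := by gcongr; linarith
  · have hcube : a ^ 3 ≤ μ * (1 - l) * (1 - √l) * lmin / (18 * L ^ 4) := by
      rw [le_div_iff₀ (by positivity)]
      have e1 : a ^ 3 * (μ ^ 3 * C ^ 3) ≤ 64 * w ^ 3 := by
        have := pow_le_pow_left₀ (by positivity) hαw 3
        calc a ^ 3 * (μ ^ 3 * C ^ 3) = (a * (μ * C)) ^ 3 := by ring
          _ ≤ (4 * w) ^ 3 := this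
          _ = _ := by ring
      -- The number is `64 · 2 · 18`: `64` from the cube of `4w`, `2` from `1 - l ≤ 2(1 - √l)`, and
      -- `18` from the condition. `C ≥ 1` allows passing from `C` to `C³`.
      have e2 : 2304 * L ^ 4 ≤ μ ^ 4 * C ^ 3 := by
        rw [div_le_iff₀ (by positivity)] at hC2
        have : C ≤ C ^ 3 := le_self_pow₀ hC3 (by norm_num)
        calc 2304 * L ^ 4 ≤ C * μ ^ 4 := hC2
          _ ≤ C ^ 3 * μ ^ 4 := by gcongr
          _ = _ := by ring
      have e3 : a ^ 3 * (2304 * L ^ 4) ≤ 64 * (μ * w ^ 3) := by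
        calc a ^ 3 * (2304 * L ^ 4) ≤ a ^ 3 * (μ ^ 4 * C ^ 3) := by gcongr
          _ = μ * (a ^ 3 * (μ ^ 3 * C ^ 3)) := by ring
          _ ≤ μ * (64 * w ^ 3) := by gcongr
          _ = _ := by ring
      have e4 : μ * w ^ 3 ≤ 2 * (μ * (1 - l) * (1 - √l) * lmin) := by
        calc μ * w ^ 3 = μ * (w * w * w) := by ring
          _ ≤ μ * ((1 - l) * 1 * w) := by gcongr
          _ = μ * (1 - l) * (1 - l) * lmin := by rw [hw]; ring
          _ ≤ μ * (1 - l) * (2 * (1 - √l)) * lmin := by gcongr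
          _ = _ := by ring
      linarith
    calc a = (a ^ 3) ^ (1 / 3 : ℝ) := by
          rw [← Real.rpow_natCast, ← Real.rpow_mul hα.le]; norm_num
      _ ≤ _ := Real.rpow_le_rpow (by positivity) hcube (by norm_num)

end Horizon

end

/-! ### Assembly of the three claims. -/

theorem corollary3 :
    -- the constant of the first bound is absolute
    ∃ C₀ : ℝ, 0 < C₀ ∧ ∀ L μ : ℝ, 0 < μ → μ ≤ L →
    -- the constant of the other bounds depends on `L` and `μ` only
    ∃ C : ℝ, 0 < C ∧
    ∀ (n d : ℕ), 0 < n → ∀ (W : Matrix (Fin n) (Fin n) ℝ),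
      IsCombinationMatrix W → W.PosSemidef →
    ∀ (f : Fin n → Vec d → ℝ) (fstar : ℝ), (∀ i, IsLSmooth L (f i)) →
      IsGLB (Set.range (aggregate f)) fstar → SatisfiesPL μ (aggregate f) fstar →
    ∀ (l lmin : ℝ), l = mixingRate W → lmin = minNonzeroEigenvalue W →
    ∀ (Ω : Type*) [MeasurableSpace Ω] (P : Measure Ω) [IsProbabilityMeasure P]
      (Ξ : Fin n → Type*) [∀ i, MeasurableSpace (Ξ i)] (G : ∀ i, Vec d → Ξ i → Vec d)
      (ξ : ℕ → ∀ i, Ω → Ξ i) (σ : ℝ) (x0 : Vec d),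
      (∀ i, Measurable (fun p : Vec d × Ξ i => G i p.1 p.2)) →
      (∀ k i, Measurable (ξ k i)) →
    -- linear rate plus error, for every admissible step size and every iteration
    (∀ α : ℝ, 0 < α → StepSizeOK L μ l lmin α →
      NoiseAssumption P f G ξ (edIterate W α G ξ x0) σ →
      ∀ k : ℕ,
        (∀ i, Integrable (fun ω => aggregate f (edIterate W α G ξ x0 k ω i)) P) ∧
        meanError P f fstar (edIterate W α G ξ x0) k ≤
          (1 - α * μ / 2) ^ k * (2 * (aggregate f x0 - fstar)
            + 8 * α ^ 2 * L * zetaSq W f x0 / ((1 - l) * lmin))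
          + C₀ * (α * L * σ ^ 2 / (μ * n)
            + α ^ 2 * L ^ 2 * l ^ 2 * σ ^ 2 / (μ * (1 - l) * lmin)
            + α ^ 4 * L ^ 4 * l ^ 2 * σ ^ 2 / (μ * (1 - l) ^ 3 * lmin * n))) ∧
    -- the rate after `K` steps with step size `2 ln(K²) / (μ K)`
    (∀ K : ℕ, 2 ≤ K → StepSizeOK L μ l lmin (horizonStep μ K) →
      NoiseAssumption P f G ξ (edIterate W (horizonStep μ K) G ξ x0) σ →
        meanError P f fstar (edIterate W (horizonStep μ K) G ξ x0) K ≤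
          2 * (aggregate f x0 - fstar) / (K : ℝ) ^ 2
          + C * Real.log K ^ 4 * (σ ^ 2 / (K * n)
            + l ^ 2 * σ ^ 2 / ((K : ℝ) ^ 2 * (1 - l) * lmin)
            + zetaSq W f x0 / ((K : ℝ) ^ 4 * (1 - l) * lmin)
            + l ^ 2 * σ ^ 2 / ((K : ℝ) ^ 4 * (1 - l) ^ 3 * lmin * n)) ∧
        -- linear speedup after the transient time `n / ((1 - λ) lmin)`
        (n / ((1 - l) * lmin) ≤ (K : ℝ) →
          meanError P f fstar (edIterate W (horizonStep μ K) G ξ x0) K ≤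
            C * Real.log K ^ 4
              * ((aggregate f x0 - fstar + σ ^ 2 + zetaSq W f x0) / (n * K)))) ∧
    -- that step size is admissible for all large `K`
    (∀ K : ℕ, 2 ≤ K → C * Real.log K / ((1 - l) * lmin) ≤ (K : ℝ) →
      StepSizeOK L μ l lmin (horizonStep μ K)) := by
  refine ⟨48, by norm_num, fun L μ hμ hμL => ?_⟩
  have hL : 0 < L := hμ.trans_le hμL
  have hH : 0 < horizonConst L μ := by unfold horizonConst; positivity
  have hA : 0 < admissibleConst L μ := by unfold admissibleConst; positivity
  -- One constant serves three bounds: the transient bound needs `3C + 32`, with `3` for its three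
  -- `σ²` terms and `32` for the initial gap via `2 ≤ 32 (ln K)⁴`, and admissibility needs the last
  -- summand.
  refine ⟨3 * horizonConst L μ + 32 + admissibleConst L μ, by positivity, ?_⟩
  intro n d hn W hW hpsd f fstar hf hglb hPL l lmin hl hlmin Ω _ P _ Ξ _ G ξ σ x0 hG hξ
  have hstar : ∀ x, fstar ≤ aggregate f x := fun x => hglb.1 ⟨x, rfl⟩
  have hgap : 0 ≤ aggregate f x0 - fstar := sub_nonneg.2 (hstar x0)
  have hz : 0 ≤ zetaSq W f x0 := by unfold zetaSq; positivity
  obtain ⟨hl0, hl1, hmin, hmin1, -, -⟩ := exists_isModalBasis hn hW hpsd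
  subst hl hlmin
  have hS : ∀ α, NoiseAssumption P f G ξ (edIterate W α G ξ x0) σ →
      IsStochasticED P W α L σ f G ξ x0 := fun α hN =>
    ⟨hn, hL, hW.doublyStochastic, hf, hG, hξ, hN⟩
  have h1l : 0 < 1 - mixingRate W := sub_pos.2 hl1
  have hb : ∀ K : ℕ, 2 ≤ K →
      StepSizeOK L μ (mixingRate W) (minNonzeroEigenvalue W) (horizonStep μ K) →
      0 ≤ 1 - horizonStep μ K * μ / 2 := fun K hK hstep => by
    have hα := horizonStep_pos hμ hK
    have h1 := hstep.mul_le hL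
    have h2 : horizonStep μ K * μ ≤ horizonStep μ K * L := by gcongr
    linarith [Real.sqrt_nonneg (mixingRate W)]
  have horizon := fun (K : ℕ) (hK : 2 ≤ K)
      (hstep : StepSizeOK L μ (mixingRate W) (minNonzeroEigenvalue W) (horizonStep μ K))
      (hN : NoiseAssumption P f G ξ (edIterate W (horizonStep μ K) G ξ x0) σ) =>
    ((hS _ hN).meanError_bound hW hpsd hμ hμL (horizonStep_pos hμ hK) hstar hPL hstep K).trans
      (horizon_bound_le hL hμ hK hn hl1 hmin hgap hz (hb K hK hstep))
  refine ⟨fun α hα hstep hN k => ⟨fun i => ?_,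
      (hS α hN).meanError_bound hW hpsd hμ hμL hα hstar hPL hstep k⟩,
    fun K hK hstep hN => ⟨(horizon K hK hstep hN).trans ?_, fun hKn => ?_⟩,
    fun K hK hCK => stepSizeOK_horizonStep hL hμ hl0 hl1 hmin hmin1 hK (by linarith) hCK⟩
  · exact (hS α hN).integrable_gap hstar ((hS α hN).memLp_iterate k i)
  · have hlog := half_le_log hK
    gcongr
    linarith
  · have hlog := half_le_log hK
    refine ((horizon K hK hstep hN).trans (transient_bound_le hK hn hl0 hl1 hmin hmin1 hgap hz
      hH.le hKn)).trans ?_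
    refine mul_le_mul_of_nonneg_right (mul_le_mul_of_nonneg_right (by linarith) (by positivity))
      (div_nonneg ?_ (by positivity))
    linarith [sq_nonneg σ]
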